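/- Let $d$ be a natural number and let $0 < \beta \le d$. Let $\mathbb{T}^d = \mathbb{R}^d/\mathbb{Z}^d$. For a finite Borel measure $\mu$ on $\mathbb{T}^d$ write $\widehat{\mu}(\xi) = \int e^{-2\pi i \xi\cdot x}\,d\mu(x)$ for $\xi \in \mathbb{Z}^d$, and for $\lambda \ge 0$ let $\|\mu\|_{M(\lambda)} = \sup_{\xi \in \mathbb{Z}^d} |\widehat{\mu}(\xi)|\,|\xi|^{\lambda/2}$. Let $M(\beta)$ be the set of finite Borel measures $\mu$ with $\|\mu\|_{M(\lambda)} < \infty$ for all $\lambda \in [0,\beta)$, with the topology given by the pseudometrics $\|\mu-\nu\|_{M(\lambda)} = \sup_{\xi}|\widehat{\mu}(\xi)-\widehat{\nu}(\xi)|\,|\xi|^{\lambda/2}$, $\lambda \in [0,\beta)$. Let $\mathcal{X}_\beta$ be the space of all pairs $(E,\mu)$ where $E \subset \mathbb{T}^d$ is compact and $\mu \in M(\beta)$ is a probability measure with $\operatorname{supp}(\mu) \subset E$, with the subspace topology of the product of the space of compact subsets of $\mathbb{T}^d$ (with the Hausdorff distance) and $M(\beta)$. The Fourier dimension of a finite Borel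 measure $\mu$ is the supremum of all $s \in [0,d]$ with $\sup_{\xi} |\widehat{\mu}(\xi)|\,|\xi|^{s/2} < \infty$; the Fourier dimension of a set $E$ is the supremum of the Fourier dimensions of all Borel probability measures $\mu$ with $\operatorname{supp}(\mu) \subset E$; and $E$ is a Salem set if its Fourier dimension equals its Hausdorff dimension. Then for quasi-all $(E,\mu) \in \mathcal{X}_\beta$ (that is, for all $(E,\mu)$ in a comeager subset of $\mathcal{X}_\beta$), the set $E$ is a Salem set of dimension exactly $\beta$: its Fourier dimension and its Hausdorff dimension both equal $\beta$. -/

import Mathlib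

open MeasureTheory TopologicalSpace Filter Topology
open scoped ENNReal NNReal

noncomputable section

namespace SalemGeneric

/-- The torus `𝕋^d = ℝ^d / ℤ^d`. (Its metric in Mathlib is the maximum metric, which is bi-Lipschitz
equivalent to the Euclidean one: Hausdorff dimensions and the topology given by the Hausdorff
distance are the same for both.) -/
abbrev Torus (d : ℕ) : Type := UnitAddTorus (Fin d)

/-- The Euclidean norm `|ξ|` of a frequency `ξ ∈ ℤ^d`. -/
def freqNorm {d : ℕ} (ξ : Fin d → ℤ) : ℝ :=
  ‖(WithLp.toLp 2 (fun i => (ξ i : ℝ)) : EuclideanSpace ℝ (Fin d))‖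

/-- The Fourier transform `μ̂(ξ) = ∫ exp(-2πi ξ·x) dμ(x)`, for `ξ ∈ ℤ^d`. -/
def fourierTransform {d : ℕ} (μ : Measure (Torus d)) (ξ : Fin d → ℤ) : ℂ :=
  ∫ x, UnitAddTorus.mFourier (-ξ) x ∂μ

/-- The weighted supremum `sup_ξ |f(ξ)| |ξ|^{l/2} ∈ [0,∞]` of a function `f` on `ℤ^d`. -/
def weightedSup {d : ℕ} (l : ℝ) (f : (Fin d → ℤ) → ℂ) : ℝ≥0∞ :=
  ⨆ ξ, ‖f ξ‖ₑ * ENNReal.ofReal (freqNorm ξ ^ (l / 2))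

/-- The seminorm `‖μ‖_{M(l)} = sup_ξ |μ̂(ξ)| |ξ|^{l/2}` (possibly infinite). -/
def fourierSeminorm {d : ℕ} (l : ℝ) (μ : Measure (Torus d)) : ℝ≥0∞ :=
  weightedSup l (fourierTransform μ)

/-- `‖μ - ν‖_{M(l)} = sup_ξ |μ̂(ξ) - ν̂(ξ)| |ξ|^{l/2}`. -/
def fourierSeminormDiff {d : ℕ} (l : ℝ) (μ ν : Measure (Torus d)) : ℝ≥0∞ :=
  weightedSup l (fun ξ => fourierTransform μ ξ - fourierTransform ν ξ)

theorem fourierSeminormDiff_self {d : ℕ} (l : ℝ) (μ : Measure (Torus d)) :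
    fourierSeminormDiff l μ μ = 0 := by
  simp [fourierSeminormDiff, weightedSup]

theorem fourierSeminormDiff_comm {d : ℕ} (l : ℝ) (μ ν : Measure (Torus d)) :
    fourierSeminormDiff l μ ν = fourierSeminormDiff l ν μ := by
  simp only [fourierSeminormDiff, weightedSup, enorm_sub_rev]

theorem fourierSeminormDiff_triangle {d : ℕ} (l : ℝ) (μ ν ρ : Measure (Torus d)) :
    fourierSeminormDiff l μ ρ ≤ fourierSeminormDiff l μ ν + fourierSeminormDiff l ν ρ := by
  refine iSup_le fun ξ => ?_
  have h : ‖fourierTransform μ ξ - fourierTransform ρ ξ‖ₑ ≤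
      ‖fourierTransform μ ξ - fourierTransform ν ξ‖ₑ +
        ‖fourierTransform ν ξ - fourierTransform ρ ξ‖ₑ := by
    have h0 := enorm_add_le (fourierTransform μ ξ - fourierTransform ν ξ)
      (fourierTransform ν ξ - fourierTransform ρ ξ)
    rwa [sub_add_sub_cancel] at h0
  refine (mul_le_mul_left h _).trans ?_
  rw [add_mul]
  exact add_le_add
    (le_iSup (fun ξ => ‖fourierTransform μ ξ - fourierTransform ν ξ‖ₑ *
      ENNReal.ofReal (freqNorm ξ ^ (l / 2))) ξ)
    (le_iSup (fun ξ => ‖fourierTransform ν ξ - fourierTransform ρ ξ‖ₑ *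
      ENNReal.ofReal (freqNorm ξ ^ (l / 2))) ξ)

/-- `M(β)`: the finite Borel measures `μ` on `𝕋^d` such that `‖μ‖_{M(l)} < ∞` for all
`l ∈ [0,β)`. -/
def MSpace (d : ℕ) (β : ℝ) : Type :=
  {μ : Measure (Torus d) //
    IsFiniteMeasure μ ∧ ∀ l : ℝ, 0 ≤ l → l < β → fourierSeminorm l μ < ∞}

/-- The pseudometric `(μ, ν) ↦ ‖μ - ν‖_{M(l)}` on `M(β)`. -/
@[reducible]
def MSpace.pseudoEMetric (d : ℕ) (β l : ℝ) : PseudoEMetricSpace (MSpace d β) where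
  edist μ ν := fourierSeminormDiff l μ.1 ν.1
  edist_self μ := fourierSeminormDiff_self l μ.1
  edist_comm μ ν := fourierSeminormDiff_comm l μ.1 ν.1
  edist_triangle μ ν ρ := fourierSeminormDiff_triangle l μ.1 ν.1 ρ.1

/-- The topology of `M(β)`: the one generated by all seminorms `‖·‖_{M(l)}`, `l ∈ [0,β)`. -/
instance MSpace.topology (d : ℕ) (β : ℝ) : TopologicalSpace (MSpace d β) :=
  ⨅ l : Set.Ico (0 : ℝ) β,
    (MSpace.pseudoEMetric d β l).toUniformSpace.toTopologicalSpace

/-- Convergence in `M(β)` is convergence in each seminorm `‖·‖_{M(l)}`, `l ∈ [0,β)`. -/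
theorem MSpace.tendsto_iff {d : ℕ} {β : ℝ} {ι : Type*} (F : Filter ι) (u : ι → MSpace d β)
    (μ : MSpace d β) :
    Tendsto u F (𝓝 μ) ↔
      ∀ l : ℝ, 0 ≤ l → l < β →
        Tendsto (fun i => fourierSeminormDiff l (u i).1 μ.1) F (𝓝 0) := by
  have key : ∀ l : ℝ,
      Tendsto u F (@nhds _ (MSpace.pseudoEMetric d β l).toUniformSpace.toTopologicalSpace μ) ↔
        Tendsto (fun i => fourierSeminormDiff l (u i).1 μ.1) F (𝓝 0) := fun l =>
    @tendsto_iff_edist_tendsto_0 _ _ (MSpace.pseudoEMetric d β l) F u μ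
  rw [nhds_iInf, tendsto_iInf]
  constructor
  · intro h l h0 h1
    exact (key l).1 (h ⟨l, h0, h1⟩)
  · intro h l
    exact (key l).2 (h l l.2.1 l.2.2)

/-- `𝒳_β`: the pairs `(E, μ)`, where `E ⊆ 𝕋^d` is compact and `μ ∈ M(β)` is a probability measure
with `supp μ ⊆ E`. It carries the subspace topology of the product of the space of compact
sets (with the Hausdorff distance) and `M(β)`. -/
def XSpace (d : ℕ) (β : ℝ) : Set (Compacts (Torus d) × MSpace d β) :=
  {p | IsProbabilityMeasure p.2.1 ∧ p.2.1.support ⊆ (p.1 : Set (Torus d))}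

/-- The Fourier dimension of a finite Borel measure `μ` on `𝕋^d`: the supremum of all `s ∈ [0,d]`
with `sup_ξ |μ̂(ξ)| |ξ|^{s/2} < ∞`. -/
def fourierDimMeasure {d : ℕ} (μ : Measure (Torus d)) : ℝ≥0∞ :=
  ⨆ (s : ℝ≥0) (_ : s ≤ d ∧ fourierSeminorm s μ < ∞), (s : ℝ≥0∞)

/-- The Fourier dimension of a set `E ⊆ 𝕋^d`: the supremum of the Fourier dimensions of all Borel
probability measures `μ` with `supp μ ⊆ E`. -/
def fourierDim {d : ℕ} (E : Set (Torus d)) : ℝ≥0∞ :=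
  ⨆ (μ : Measure (Torus d)) (_ : IsProbabilityMeasure μ ∧ μ.support ⊆ E), fourierDimMeasure μ

/-- A Salem set: its Fourier dimension agrees with its Hausdorff dimension. -/
def IsSalem {d : ℕ} (E : Set (Torus d)) : Prop :=
  fourierDim E = dimH E

end SalemGeneric

end

noncomputable section

namespace SalemGeneric

open ProbabilityTheory

/-! The lower bound holds for every pair, not just generically. The measure of a pair in `XSpace d
β` has finite seminorms below `β ≤ d`, so the Fourier dimension of its set is at least `β`
(`ofReal_le_fourierDim`), and Fourier dimension never exceeds Hausdorff dimension
(`fourierDim_le_dimH`). What remains is that generically `dimH E ≤ β`.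

For `t > β` and `δ > 0`, having a finite cover by balls of radius at most `δ` with `∑ (2 r) ^ t ≤ δ`
is an open condition on `E`. If it is also dense, intersecting over countably many `t ↓ β` and `δ ↓
0` gives a comeager set on which `dimH E ≤ β`.

Density (`exists_approx`, `exists_XSpace_near`) is probabilistic. Sample `N` points of `E`
independently from `μ`, and convolve their empirical measure with a smooth bump of width about `h`.
With cutoff `M`, Hoeffding's inequality and a union bound control the sampling error on the
polynomially many frequencies up to `M`; the bump suppresses the others because `h` is much larger
than `1 / M`. Since `l < β < t`, there is room for `N` to exceed `M ^ l` by a power while `N * h ^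
t` still tends to `0`. The new set consists of `N` small balls and a finite net of `E`; the net
makes it Hausdorff-close to `E` at negligible covering cost.

For `fourierDim_le_dimH`, the second moment of a Dirichlet kernel under `μ × μ` bounds the mass of
pairs at distance at most `r` (`exists_prod_dist_le`), and a dyadic mass distribution argument turns
this into a dimension bound. -/

/-! ### Concentration and random sampling -/

/-- Hoeffding: a variable with values in `[-1, 1]` is sub-Gaussian with parameter `1` after
centring, so a sum of `N` independent copies has parameter `N`, and `(N s)² / (2 N) = N s² / 2`. -/
theorem measureReal_pi_sum_ge_le {α : Type*} [MeasurableSpace α] (μ : Measure α)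
    [IsProbabilityMeasure μ] {f : α → ℝ} (hf : Measurable f) (hb : ∀ x, |f x| ≤ 1) (N : ℕ)
    {s : ℝ} (hs : 0 ≤ s) :
    (Measure.pi fun _ : Fin N => μ).real {X | N * s ≤ ∑ j, (f (X j) - ∫ x, f x ∂μ)} ≤
      Real.exp (-(N * s ^ 2 / 2)) := by
  have hsub : HasSubgaussianMGF (fun x => f x - ∫ x, f x ∂μ) ((‖(1 : ℝ) - (-1)‖₊ / 2) ^ 2) μ :=
    hasSubgaussianMGF_of_mem_Icc hf.aemeasurable (ae_of_all _ fun x => abs_le.1 (hb x))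
  have hc : ((‖(1 : ℝ) - (-1)‖₊ / 2) ^ 2 : ℝ≥0) = 1 := by
    ext; simp; norm_num
  rw [hc] at hsub
  have hind : iIndepFun (fun (j : Fin N) (X : Fin N → α) => f (X j) - ∫ x, f x ∂μ)
      (Measure.pi fun _ : Fin N => μ) :=
    iIndepFun_pi (X := fun _ x => f x - ∫ x, f x ∂μ) fun _ => (hf.sub_const _).aemeasurable
  have hg : ∀ j ∈ (Finset.univ : Finset (Fin N)),
      HasSubgaussianMGF (fun X : Fin N → α => f (X j) - ∫ x, f x ∂μ) 1
        (Measure.pi fun _ : Fin N => μ) := by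
    intro j _
    have hmp := measurePreserving_eval (fun _ : Fin N => μ) j
    refine HasSubgaussianMGF.of_map (X := fun x => f x - ∫ x, f x ∂μ)
      (Y := fun X : Fin N → α => X j) hmp.measurable.aemeasurable ?_
    have hm : Measure.map (fun X : Fin N → α => X j) (Measure.pi fun _ : Fin N => μ) = μ := hmp.map_eq
    rwa [hm]
  have h := HasSubgaussianMGF.measure_sum_ge_le_of_iIndepFun hind hg (ε := N * s) (by positivity)
  refine h.trans (le_of_eq ?_)
  congr 1
  rcases Nat.eq_zero_or_pos N with rfl | hN
  · simp
  · have : (N : ℝ) ≠ 0 := by positivity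
    simp
    field_simp

theorem measureReal_pi_abs_sum_ge_le {α : Type*} [MeasurableSpace α] (μ : Measure α)
    [IsProbabilityMeasure μ] {f : α → ℝ} (hf : Measurable f) (hb : ∀ x, |f x| ≤ 1) (N : ℕ)
    {s : ℝ} (hs : 0 ≤ s) :
    (Measure.pi fun _ : Fin N => μ).real {X | N * s ≤ |∑ j, (f (X j) - ∫ x, f x ∂μ)|} ≤
      2 * Real.exp (-(N * s ^ 2 / 2)) := by
  have h1 := measureReal_pi_sum_ge_le μ hf hb N hs
  have h2 := measureReal_pi_sum_ge_le μ hf.neg (by simpa using hb) N hs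
  have hsub : {X : Fin N → α | N * s ≤ |∑ j, (f (X j) - ∫ x, f x ∂μ)|} ⊆
      {X | N * s ≤ ∑ j, (f (X j) - ∫ x, f x ∂μ)} ∪
        {X | N * s ≤ ∑ j, ((-f) (X j) - ∫ x, (-f) x ∂μ)} := by
    intro X hX
    rcases le_abs.1 (show N * s ≤ |∑ j, (f (X j) - ∫ x, f x ∂μ)| from hX) with h | h
    · exact Or.inl h
    · right
      simp only [Pi.neg_apply, integral_neg, Set.mem_ofPred_eq]
      refine h.trans (le_of_eq ?_)
      rw [← Finset.sum_neg_distrib]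
      exact Finset.sum_congr rfl fun _ _ => by ring
  calc _ ≤ _ := measureReal_mono hsub
    _ ≤ _ := measureReal_union_le _ _
    _ ≤ _ := by linarith

theorem norm_mFourier_apply {d : ℕ} (ξ : Fin d → ℤ) (x : Torus d) :
    ‖UnitAddTorus.mFourier ξ x‖ = 1 := by
  simp [UnitAddTorus.mFourier, norm_prod, fourier_apply, Circle.norm_coe]

theorem integrable_mFourier {d : ℕ} (μ : Measure (Torus d)) [IsFiniteMeasure μ] (ξ : Fin d → ℤ) :
    Integrable (fun x => UnitAddTorus.mFourier ξ x) μ :=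
  Integrable.of_bound (UnitAddTorus.mFourier ξ).continuous.aestronglyMeasurable 1
    (ae_of_all _ fun x => (norm_mFourier_apply ξ x).le)

theorem norm_fourierTransform_le {d : ℕ} (μ : Measure (Torus d)) [IsProbabilityMeasure μ]
    (ξ : Fin d → ℤ) : ‖fourierTransform μ ξ‖ ≤ 1 := by
  simpa [fourierTransform] using norm_integral_le_of_norm_le_const (μ := μ) (C := 1)
    (ae_of_all _ fun x => (norm_mFourier_apply (-ξ) x).le)

theorem fourierTransform_zero {d : ℕ} (μ : Measure (Torus d)) [IsProbabilityMeasure μ] :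
    fourierTransform μ 0 = 1 := by
  simp [fourierTransform, UnitAddTorus.mFourier_zero]

/-- Random sampling: the empirical measure of suitable points `X j ∈ E` approximates the Fourier
transform of `μ` on a finite set of frequencies. -/
theorem exists_sample {d : ℕ} (μ : Measure (Torus d)) [IsProbabilityMeasure μ] {E : Set (Torus d)}
    (hE : ∀ᵐ x ∂μ, x ∈ E) (S : Finset (Fin d → ℤ)) {N : ℕ} {s : ℝ} (hN : 0 < N)
    (hs : 0 ≤ s) (h : S.card * (4 * Real.exp (-(N * s ^ 2 / 2))) < 1) :
    ∃ X : Fin N → Torus d, (∀ j, X j ∈ E) ∧ ∀ ξ ∈ S,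
      ‖(N : ℂ)⁻¹ * ∑ j, UnitAddTorus.mFourier (-ξ) (X j) - fourierTransform μ ξ‖ ≤ 2 * s := by
  let P : Measure (Fin N → Torus d) := Measure.pi fun _ => μ
  let R : (Fin d → ℤ) → Torus d → ℝ := fun ξ x => (UnitAddTorus.mFourier (-ξ) x).re
  let I : (Fin d → ℤ) → Torus d → ℝ := fun ξ x => (UnitAddTorus.mFourier (-ξ) x).im
  let bad : (Torus d → ℝ) → Set (Fin N → Torus d) :=
    fun f => {X | N * s ≤ |∑ j, (f (X j) - ∫ x, f x ∂μ)|}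
  have hR : ∀ ξ, P.real (bad (R ξ)) ≤ 2 * Real.exp (-(N * s ^ 2 / 2)) := fun ξ =>
    measureReal_pi_abs_sum_ge_le μ
      (Complex.measurable_re.comp (UnitAddTorus.mFourier (-ξ)).continuous.measurable)
      (fun x => (Complex.abs_re_le_norm _).trans (norm_mFourier_apply _ x).le) N hs
  have hI : ∀ ξ, P.real (bad (I ξ)) ≤ 2 * Real.exp (-(N * s ^ 2 / 2)) := fun ξ =>
    measureReal_pi_abs_sum_ge_le μ
      (Complex.measurable_im.comp (UnitAddTorus.mFourier (-ξ)).continuous.measurable)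
      (fun x => (Complex.abs_im_le_norm _).trans (norm_mFourier_apply _ x).le) N hs
  -- Union bound: each frequency contributes two tails for the real part and two for the imaginary
  -- part, hence the factor `4`.
  have hB : P.real (⋃ ξ ∈ S, (bad (R ξ) ∪ bad (I ξ))) < 1 := by
    refine lt_of_le_of_lt (measureReal_biUnion_finset_le _ _) (lt_of_le_of_lt ?_ h)
    rw [← nsmul_eq_mul]
    refine Finset.sum_le_card_nsmul _ _ _ fun ξ _ => (measureReal_union_le _ _).trans ?_
    linarith [hR ξ, hI ξ]
  have hEE : ∀ᵐ X ∂P, ∀ j, X j ∈ E := by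
    rw [eventually_countable_forall]
    intro j
    exact (measurePreserving_eval (fun _ : Fin N => μ) j).quasiMeasurePreserving.ae hE
  obtain ⟨X, hX, hXE⟩ : ∃ X, X ∉ (⋃ ξ ∈ S, (bad (R ξ) ∪ bad (I ξ))) ∧ ∀ j, X j ∈ E := by
    by_contra! hcon
    have : ∀ᵐ X ∂P, X ∈ (⋃ ξ ∈ S, (bad (R ξ) ∪ bad (I ξ))) := by
      filter_upwards [hEE] with X hX
      by_contra hX'
      obtain ⟨j, hj⟩ := hcon X hX'
      exact hj (hX j)
    have h1 : P (⋃ ξ ∈ S, (bad (R ξ) ∪ bad (I ξ))) = 1 := by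
      exact (measure_congr (eventuallyEq_univ.2 this)).trans measure_univ
    rw [Measure.real, h1] at hB
    simp at hB
  refine ⟨X, hXE, fun ξ hξ => ?_⟩
  simp only [Set.mem_iUnion, not_exists, Set.mem_union, not_or] at hX
  obtain ⟨h1, h2⟩ := hX ξ hξ
  replace h1 : |∑ j, (R ξ (X j) - ∫ x, R ξ x ∂μ)| < N * s := not_le.1 h1
  replace h2 : |∑ j, (I ξ (X j) - ∫ x, I ξ x ∂μ)| < N * s := not_le.1 h2
  have hint := integrable_mFourier μ (-ξ)
  set Z : ℂ := ∑ j, (UnitAddTorus.mFourier (-ξ) (X j) - fourierTransform μ ξ) with hZ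
  have hre : Z.re = ∑ j, (R ξ (X j) - ∫ x, R ξ x ∂μ) := by
    rw [hZ, Complex.re_sum]
    refine Finset.sum_congr rfl fun j _ => ?_
    rw [Complex.sub_re, fourierTransform]
    congr 1
    exact (integral_re hint).symm
  have him : Z.im = ∑ j, (I ξ (X j) - ∫ x, I ξ x ∂μ) := by
    rw [hZ, Complex.im_sum]
    refine Finset.sum_congr rfl fun j _ => ?_
    rw [Complex.sub_im, fourierTransform]
    congr 1
    exact (integral_im hint).symm
  have hN' : (N : ℂ) ≠ 0 := by exact_mod_cast hN.ne'
  have hZe : (N : ℂ)⁻¹ * ∑ j, UnitAddTorus.mFourier (-ξ) (X j) - fourierTransform μ ξ =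
      (N : ℂ)⁻¹ * Z := by
    rw [hZ, Finset.sum_sub_distrib]
    simp
    field_simp
  have hn : ‖Z‖ ≤ 2 * (N * s) := by
    refine (Complex.norm_le_abs_re_add_abs_im Z).trans ?_
    rw [hre, him]; linarith
  rw [hZe, norm_mul, norm_inv, Complex.norm_natCast]
  have hN'' : (0 : ℝ) < N := by exact_mod_cast hN
  rw [inv_mul_le_iff₀ hN'']
  linarith

/-! ### The norm of a frequency and its coordinates -/

theorem freqNorm_nonneg {d : ℕ} (ξ : Fin d → ℤ) : 0 ≤ freqNorm ξ := norm_nonneg _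

@[simp] theorem freqNorm_zero {d : ℕ} : freqNorm (0 : Fin d → ℤ) = 0 := by
  rw [freqNorm, norm_eq_zero]; ext i; simp

theorem abs_le_freqNorm {d : ℕ} (ξ : Fin d → ℤ) (i : Fin d) : |(ξ i : ℝ)| ≤ freqNorm ξ := by
  simpa [freqNorm] using
    PiLp.norm_apply_le (WithLp.toLp 2 (fun i => (ξ i : ℝ)) : EuclideanSpace ℝ (Fin d)) i

theorem one_le_freqNorm {d : ℕ} {ξ : Fin d → ℤ} (h : ξ ≠ 0) : 1 ≤ freqNorm ξ := by
  obtain ⟨i, hi⟩ := Function.ne_iff.1 h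
  refine le_trans ?_ (abs_le_freqNorm ξ i)
  exact_mod_cast Int.one_le_abs hi

theorem freqNorm_le_sum {d : ℕ} (ξ : Fin d → ℤ) : freqNorm ξ ≤ ∑ i, |(ξ i : ℝ)| := by
  rw [freqNorm, EuclideanSpace.norm_eq]
  have h0 : 0 ≤ ∑ i, |(ξ i : ℝ)| := Finset.sum_nonneg fun i _ => abs_nonneg _
  rw [Real.sqrt_le_left h0, sq, Finset.sum_mul]
  refine Finset.sum_le_sum fun i _ => ?_
  rw [Real.norm_eq_abs, sq]
  exact mul_le_mul_of_nonneg_left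
    (Finset.single_le_sum (f := fun i => |(ξ i : ℝ)|) (fun j _ => abs_nonneg _)
      (Finset.mem_univ i)) (abs_nonneg _)

theorem exists_freqNorm_le {d : ℕ} {ξ : Fin d → ℤ} (h : ξ ≠ 0) :
    ∃ i, freqNorm ξ ≤ d * |(ξ i : ℝ)| := by
  by_contra! hcon
  obtain ⟨i, hi⟩ := Function.ne_iff.1 h
  have hd : (0 : ℝ) < d := by
    have := i.pos
    exact_mod_cast this
  have h1 : ∑ i, d * |(ξ i : ℝ)| < ∑ _i : Fin d, freqNorm ξ :=
    Finset.sum_lt_sum_of_nonempty ⟨i, Finset.mem_univ i⟩ fun i _ => hcon i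
  rw [← Finset.mul_sum] at h1
  simp only [Finset.sum_const, Finset.card_univ, Fintype.card_fin, nsmul_eq_mul] at h1
  have := freqNorm_le_sum ξ
  nlinarith [lt_of_mul_lt_mul_left h1 hd.le]

/-! ### Mollifiers: small support and Fourier decay of any order -/

/-- The law of `h U mod 1`, where `U` is uniform on `[0,1]`. -/
def segmentMeasure (h : ℝ) : Measure UnitAddCircle :=
  (volume.restrict (Set.Icc (0 : ℝ) 1)).map fun x => ((h * x : ℝ) : UnitAddCircle)

theorem measurable_coe_mul (h : ℝ) : Measurable fun x : ℝ => ((h * x : ℝ) : UnitAddCircle) :=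
  AddCircle.measurable_mk'.comp (measurable_const_mul h)

instance (h : ℝ) : IsProbabilityMeasure (segmentMeasure h) := by
  have : IsProbabilityMeasure (volume.restrict (Set.Icc (0 : ℝ) 1)) := ⟨by simp⟩
  exact Measure.isProbabilityMeasure_map (measurable_coe_mul h).aemeasurable

theorem norm_le_segmentMeasure {h : ℝ} (hh : 0 ≤ h) : ∀ᵐ x ∂segmentMeasure h, ‖x‖ ≤ h := by
  rw [segmentMeasure, ae_map_iff (measurable_coe_mul h).aemeasurable
    (isClosed_le continuous_norm continuous_const).measurableSet,
    ae_restrict_iff' measurableSet_Icc]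
  refine ae_of_all _ fun x hx => ?_
  have h1 : ‖((h * x : ℝ) : UnitAddCircle)‖ ≤ |h * x| := by
    have := (QuotientAddGroup.norm_mk_le_norm (S := AddSubgroup.zmultiples (1 : ℝ)) (m := h * x))
    simpa using this
  refine h1.trans ?_
  rw [abs_of_nonneg (mul_nonneg hh hx.1)]
  exact mul_le_of_le_one_right hh hx.2

theorem norm_integral_segmentMeasure_le (h : ℝ) (n : ℤ) :
    ‖∫ x, fourier n x ∂segmentMeasure h‖ ≤ 1 := by
  simpa using norm_integral_le_of_norm_le_const (μ := segmentMeasure h) (C := 1)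
    (f := fun x => fourier n x) (ae_of_all _ fun x => by simp [fourier_apply, Circle.norm_coe])

/-- The integral is `(exp (2πinh) - 1) / (2πinh)` for `n ≠ 0`, of modulus at most `1 / (πh|n|)`. -/
theorem norm_integral_segmentMeasure_mul_le {h : ℝ} (hh : 0 < h) (n : ℤ) :
    ‖∫ x, fourier n x ∂segmentMeasure h‖ * (h * |(n : ℝ)|) ≤ 1 := by
  rcases eq_or_ne n 0 with rfl | hn
  · simp
  have hc : (2 * Real.pi * Complex.I * n * h : ℂ) ≠ 0 := by
    have := Real.pi_ne_zero
    simp [hn, hh.ne', this]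
  have h1 : ∫ x, fourier n x ∂segmentMeasure h =
      ∫ x in (0 : ℝ)..1, Complex.exp ((2 * Real.pi * Complex.I * n * h : ℂ) * x) := by
    rw [segmentMeasure, integral_map (measurable_coe_mul h).aemeasurable
      (fourier n).continuous.aestronglyMeasurable, intervalIntegral.integral_of_le zero_le_one,
      integral_Icc_eq_integral_Ioc]
    refine integral_congr_ae (ae_of_all _ fun x => ?_)
    simp only [fourier_coe_apply]
    congr 1
    push_cast
    ring
  have hn' : (0 : ℝ) < |(n : ℝ)| := abs_pos.2 (by exact_mod_cast hn)
  rw [h1, integral_exp_mul_complex hc, norm_div]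
  have h2 : ‖(2 * Real.pi * Complex.I * n * h : ℂ)‖ = 2 * Real.pi * (h * |(n : ℝ)|) := by
    simp [abs_of_pos hh, abs_of_pos Real.pi_pos]
    ring
  have h3 : ‖Complex.exp ((2 * Real.pi * Complex.I * n * h : ℂ) * (1 : ℝ)) -
      Complex.exp ((2 * Real.pi * Complex.I * n * h : ℂ) * (0 : ℝ))‖ ≤ 2 := by
    refine (norm_sub_le _ _).trans ?_
    rw [Complex.norm_exp, Complex.norm_exp]
    simp
    norm_num
  rw [h2, div_mul_eq_mul_div, div_le_iff₀ (by positivity)]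
  have := Real.two_le_pi
  have h4 : 0 < h * |(n : ℝ)| := by positivity
  nlinarith

/-- The law of `h U mod 1`, where `U` is uniform on the cube `[0,1]^d`. -/
def boxMeasure (d : ℕ) (h : ℝ) : Measure (Torus d) := Measure.pi fun _ => segmentMeasure h

instance (d : ℕ) (h : ℝ) : IsProbabilityMeasure (boxMeasure d h) := by
  unfold boxMeasure; infer_instance

theorem norm_le_boxMeasure (d : ℕ) {h : ℝ} (hh : 0 ≤ h) : ∀ᵐ x ∂boxMeasure d h, ‖x‖ ≤ h := by
  have : ∀ᵐ x ∂boxMeasure d h, ∀ i, ‖x i‖ ≤ h := by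
    rw [eventually_countable_forall]
    exact fun i => (measurePreserving_eval (fun _ : Fin d => segmentMeasure h)
      i).quasiMeasurePreserving.ae (norm_le_segmentMeasure hh)
  filter_upwards [this] with x hx using (pi_norm_le_iff_of_nonneg hh).2 hx

theorem fourierTransform_boxMeasure {d : ℕ} (h : ℝ) (ξ : Fin d → ℤ) :
    fourierTransform (boxMeasure d h) ξ = ∏ i, ∫ x, fourier (-ξ i) x ∂segmentMeasure h := by
  rw [fourierTransform, boxMeasure]
  exact integral_fintype_prod_eq_prod (fun (i : Fin d) (x : UnitAddCircle) => fourier (-ξ i) x)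

/-- The transform is a product of factors of modulus at most `1`. Keeping only a coordinate with `|ξ
i| ≥ |ξ| / d` gives decay of order one; the `K`-fold convolution raises this to order `K`. -/
theorem norm_fourierTransform_boxMeasure_mul_le {d : ℕ} {h : ℝ} (hh : 0 < h) (ξ : Fin d → ℤ) :
    ‖fourierTransform (boxMeasure d h) ξ‖ * (h * freqNorm ξ) ≤ d := by
  rcases eq_or_ne ξ 0 with rfl | hξ
  · simp
  obtain ⟨i, hi⟩ := exists_freqNorm_le hξ
  have h1 : ‖fourierTransform (boxMeasure d h) ξ‖ ≤ ‖∫ x, fourier (-ξ i) x ∂segmentMeasure h‖ := by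
    rw [fourierTransform_boxMeasure, norm_prod, ← Finset.mul_prod_erase _ _ (Finset.mem_univ i)]
    exact mul_le_of_le_one_right (norm_nonneg _) (Finset.prod_le_one (fun _ _ => norm_nonneg _)
      fun j _ => norm_integral_segmentMeasure_le h _)
  have h2 := norm_integral_segmentMeasure_mul_le hh (-ξ i)
  push_cast at h2
  rw [abs_neg] at h2
  calc _ ≤ ‖∫ x, fourier (-ξ i) x ∂segmentMeasure h‖ * (h * (d * |(ξ i : ℝ)|)) :=
      mul_le_mul h1 (mul_le_mul_of_nonneg_left hi hh.le)
        (mul_nonneg hh.le (freqNorm_nonneg ξ)) (norm_nonneg _)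
    _ = d * (‖∫ x, fourier (-ξ i) x ∂segmentMeasure h‖ * (h * |(ξ i : ℝ)|)) := by ring
    _ ≤ d * 1 := by gcongr
    _ = d := mul_one _

theorem fourierTransform_conv {d : ℕ} (μ ν : Measure (Torus d)) [IsProbabilityMeasure μ]
    [IsProbabilityMeasure ν] (ξ : Fin d → ℤ) :
    fourierTransform (μ ∗ ν) ξ = fourierTransform μ ξ * fourierTransform ν ξ := by
  have hadd : ∀ x y : Torus d, UnitAddTorus.mFourier (-ξ) (x + y) =
      UnitAddTorus.mFourier (-ξ) x * UnitAddTorus.mFourier (-ξ) y := by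
    intro x y
    simp [UnitAddTorus.mFourier, fourier_apply, AddCircle.toCircle_add, Finset.prod_mul_distrib]
  rw [fourierTransform, integral_conv (integrable_mFourier _ _)]
  simp only [hadd, integral_const_mul, integral_mul_const]
  rfl

/-- The `K`-fold convolution power of `boxMeasure d h`, an approximate identity. -/
def mollifier (d : ℕ) (h : ℝ) : ℕ → Measure (Torus d)
  | 0 => Measure.dirac 0
  | K + 1 => boxMeasure d h ∗ mollifier d h K

instance (d : ℕ) (h : ℝ) (K : ℕ) : IsProbabilityMeasure (mollifier d h K) := by
  induction K with
  | zero => unfold mollifier; infer_instance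
  | succ K ih => unfold mollifier; infer_instance

theorem fourierTransform_mollifier {d : ℕ} (h : ℝ) (K : ℕ) (ξ : Fin d → ℤ) :
    fourierTransform (mollifier d h K) ξ = fourierTransform (boxMeasure d h) ξ ^ K := by
  induction K with
  | zero =>
    rw [mollifier, fourierTransform, integral_dirac]
    simp [UnitAddTorus.mFourier]
  | succ K ih => rw [mollifier, fourierTransform_conv, ih, pow_succ']

theorem norm_fourierTransform_mollifier_mul_le {d : ℕ} {h : ℝ} (hh : 0 < h) (K : ℕ)
    (ξ : Fin d → ℤ) :
    ‖fourierTransform (mollifier d h K) ξ‖ * (h * freqNorm ξ) ^ K ≤ (d : ℝ) ^ K := by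
  rw [fourierTransform_mollifier, norm_pow, ← mul_pow]
  exact pow_le_pow_left₀ (mul_nonneg (norm_nonneg _) (mul_nonneg hh.le (freqNorm_nonneg ξ)))
    (norm_fourierTransform_boxMeasure_mul_le hh ξ) K

theorem ae_conv_of_forall {d : ℕ} {μ ν : Measure (Torus d)} [SFinite μ] [SFinite ν]
    {A B C : Set (Torus d)}
    (hA : ∀ᵐ x ∂μ, x ∈ A) (hB : ∀ᵐ x ∂ν, x ∈ B) (hC : MeasurableSet C)
    (h : ∀ x ∈ A, ∀ y ∈ B, x + y ∈ C) : ∀ᵐ x ∂(μ ∗ ν), x ∈ C := by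
  rw [Measure.conv, ae_map_iff (p := fun x => x ∈ C) (by fun_prop) hC]
  filter_upwards [Measure.quasiMeasurePreserving_fst.ae hA,
    Measure.quasiMeasurePreserving_snd.ae hB] with p h1 h2 using h _ h1 _ h2

theorem norm_le_mollifier (d : ℕ) {h : ℝ} (hh : 0 ≤ h) (K : ℕ) :
    ∀ᵐ x ∂mollifier d h K, ‖x‖ ≤ K * h := by
  induction K with
  | zero =>
    rw [mollifier, ae_dirac_eq]
    simp
  | succ K ih =>
    rw [mollifier]
    refine ae_conv_of_forall (A := {x | ‖x‖ ≤ h}) (B := {x | ‖x‖ ≤ K * h})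
      (C := {x | ‖x‖ ≤ (K + 1 : ℕ) * h}) (norm_le_boxMeasure d hh) ih
      (isClosed_le continuous_norm continuous_const).measurableSet fun x hx y hy => ?_
    refine (norm_add_le x y).trans ?_
    have h1 : ‖x‖ ≤ h := hx
    have h2 : ‖y‖ ≤ K * h := hy
    push_cast
    linarith

theorem tendsto_fourierTransform_mollifier {d : ℕ} (K : ℕ) (ξ : Fin d → ℤ) :
    Tendsto (fun h => fourierTransform (mollifier d h K) ξ) (𝓝[>] 0) (𝓝 1) := by
  rw [Metric.tendsto_nhds]
  intro ε hε
  have hcont := (UnitAddTorus.mFourier (-ξ)).continuous.tendsto (0 : Torus d)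
  have h0 : UnitAddTorus.mFourier (-ξ) (0 : Torus d) = 1 := by simp [UnitAddTorus.mFourier]
  rw [h0, Metric.tendsto_nhds_nhds] at hcont
  obtain ⟨δ, hδ, hcont⟩ := hcont (ε / 2) (half_pos hε)
  have hK : Tendsto (fun h : ℝ => K * h) (𝓝[>] 0) (𝓝 0) := by
    have : Tendsto (fun h : ℝ => K * h) (𝓝 0) (𝓝 (K * 0)) := tendsto_id.const_mul _
    rw [mul_zero] at this
    exact this.mono_left nhdsWithin_le_nhds
  filter_upwards [hK.eventually (gt_mem_nhds hδ), self_mem_nhdsWithin] with h hh (hpos : 0 < h)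
  have h1 : fourierTransform (mollifier d h K) ξ - 1 =
      ∫ x, (UnitAddTorus.mFourier (-ξ) x - 1) ∂mollifier d h K := by
    rw [integral_sub (integrable_mFourier _ _) (integrable_const _)]
    simp [fourierTransform]
  rw [dist_eq_norm, h1]
  refine lt_of_le_of_lt (norm_integral_le_of_norm_le_const (C := ε / 2) ?_) ?_
  · filter_upwards [norm_le_mollifier d hpos.le K] with x hx
    rw [← dist_eq_norm]
    exact (hcont (by rw [dist_zero_right]; exact hx.trans_lt hh)).le
  · simp; linarith

/-! ### Empirical measures, weighted suprema and frequency boxes -/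

/-- The uniform probability measure on the points `X j`. -/
def empirical {d N : ℕ} (X : Fin N → Torus d) : Measure (Torus d) :=
  (N : ℝ≥0∞)⁻¹ • ∑ j, Measure.dirac (X j)

theorem isProbabilityMeasure_empirical {d N : ℕ} (hN : 0 < N) (X : Fin N → Torus d) :
    IsProbabilityMeasure (empirical X) := by
  constructor
  simp [empirical, Measure.finsetSum_apply]
  exact ENNReal.inv_mul_cancel (by simpa using hN.ne') (by simp)

theorem fourierTransform_empirical {d N : ℕ} (X : Fin N → Torus d) (ξ : Fin d → ℤ) :
    fourierTransform (empirical X) ξ = (N : ℂ)⁻¹ * ∑ j, UnitAddTorus.mFourier (-ξ) (X j) := by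
  rw [fourierTransform, empirical, integral_smul_measure,
    integral_finsetSum_measure fun j _ => integrable_mFourier _ _]
  simp

theorem ae_mem_empirical {d N : ℕ} (X : Fin N → Torus d) :
    ∀ᵐ x ∂empirical X, x ∈ Set.range X := by
  refine Measure.ae_smul_measure ?_ _
  rw [ae_iff, Measure.finsetSum_apply]
  refine Finset.sum_eq_zero fun j _ => ?_
  rw [← ae_iff, ae_dirac_eq]
  exact ⟨j, rfl⟩

theorem weightedSup_le_ofReal {d : ℕ} {l C : ℝ} {f : (Fin d → ℤ) → ℂ}
    (h : ∀ ξ, ‖f ξ‖ * freqNorm ξ ^ (l / 2) ≤ C) : weightedSup l f ≤ ENNReal.ofReal C := by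
  refine iSup_le fun ξ => ?_
  rw [← ofReal_norm, ← ENNReal.ofReal_mul (norm_nonneg _)]
  exact ENNReal.ofReal_le_ofReal (h ξ)

theorem exists_bound_of_weightedSup_lt_top {d : ℕ} {l : ℝ} {f : (Fin d → ℤ) → ℂ}
    (h : weightedSup l f < ∞) : ∃ C, 0 ≤ C ∧ ∀ ξ, ‖f ξ‖ * freqNorm ξ ^ (l / 2) ≤ C := by
  refine ⟨(weightedSup l f).toReal, ENNReal.toReal_nonneg, fun ξ => ?_⟩
  rw [← ENNReal.ofReal_le_iff_le_toReal h.ne, ENNReal.ofReal_mul (norm_nonneg _),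
    ofReal_norm]
  exact le_iSup (fun ξ => ‖f ξ‖ₑ * ENNReal.ofReal (freqNorm ξ ^ (l / 2))) ξ

/-- The frequencies with all coordinates in `[-M, M]`. -/
def freqBox (d M : ℕ) : Finset (Fin d → ℤ) := Fintype.piFinset fun _ => Finset.Icc (-M : ℤ) M

theorem card_freqBox (d M : ℕ) : (freqBox d M).card = (2 * M + 1) ^ d := by
  rw [freqBox, Fintype.card_piFinset]
  simp only [Int.card_Icc, Finset.prod_const, Finset.card_univ, Fintype.card_fin]
  congr 1
  omega

theorem lt_freqNorm_of_notMem_freqBox {d M : ℕ} {ξ : Fin d → ℤ} (h : ξ ∉ freqBox d M) :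
    (M : ℝ) < freqNorm ξ := by
  simp only [freqBox, Fintype.mem_piFinset, Finset.mem_Icc, ← abs_le, not_forall, not_le] at h
  obtain ⟨i, hi⟩ := h
  exact lt_of_lt_of_le (by exact_mod_cast hi) (abs_le_freqNorm ξ i)

theorem freqNorm_le_of_mem_freqBox {d M : ℕ} {ξ : Fin d → ℤ} (h : ξ ∈ freqBox d M) :
    freqNorm ξ ≤ d * M := by
  simp only [freqBox, Fintype.mem_piFinset, Finset.mem_Icc, ← abs_le] at h
  refine (freqNorm_le_sum ξ).trans ((Finset.sum_le_card_nsmul _ _ (M : ℝ) fun i _ => ?_).trans ?_)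
  · exact_mod_cast h i
  · simp

/-! ### Smoothing in the Fourier seminorms -/

theorem tendsto_natCast_rpow_neg {p : ℝ} (hp : 0 < p) :
    Tendsto (fun M : ℕ => (M : ℝ) ^ (-p)) atTop (𝓝 0) :=
  (tendsto_rpow_neg_atTop hp).comp tendsto_natCast_atTop_atTop

/-- The spare decay `l' > l` of `μ` makes the high frequencies small uniformly in `h`; on the
finitely many others, pointwise convergence of the mollifier's transform to `1` suffices. -/
theorem eventually_mollifier_sub_one_le {d : ℕ} (μ : Measure (Torus d)) {l l' : ℝ}
    (hll' : l < l') (hμ : fourierSeminorm l' μ < ∞) (K : ℕ) {ε : ℝ} (hε : 0 < ε) :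
    ∀ᶠ h in 𝓝[>] (0 : ℝ), ∀ ξ, ‖(fourierTransform (mollifier d h K) ξ - 1) *
      fourierTransform μ ξ‖ * freqNorm ξ ^ (l / 2) ≤ ε := by
  obtain ⟨C, hC, hμC⟩ := exists_bound_of_weightedSup_lt_top hμ
  have hlim : Tendsto (fun M : ℕ => 2 * C * (M : ℝ) ^ (-((l' - l) / 2))) atTop (𝓝 0) := by
    simpa using (tendsto_natCast_rpow_neg (p := (l' - l) / 2) (by linarith)).const_mul (2 * C)
  obtain ⟨M, hM, hM1⟩ := ((hlim.eventually (ge_mem_nhds hε)).and (eventually_ge_atTop 1)).exists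
  have hfin : ∀ᶠ h in 𝓝[>] (0 : ℝ), ∀ ξ ∈ freqBox d M,
      ‖(fourierTransform (mollifier d h K) ξ - 1) *
        fourierTransform μ ξ‖ * freqNorm ξ ^ (l / 2) ≤ ε := by
    rw [Filter.eventually_all_finset]
    intro ξ _
    have h1 : Tendsto (fun h => ‖(fourierTransform (mollifier d h K) ξ - 1) *
        fourierTransform μ ξ‖ * freqNorm ξ ^ (l / 2)) (𝓝[>] 0) (𝓝 0) := by
      have := ((((tendsto_fourierTransform_mollifier K ξ).sub_const 1).mul_const
        (fourierTransform μ ξ)).norm).mul_const (freqNorm ξ ^ (l / 2))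
      simpa using this
    exact h1.eventually (ge_mem_nhds hε)
  filter_upwards [hfin] with h hh ξ
  by_cases hξ : ξ ∈ freqBox d M
  · exact hh ξ hξ
  have hlt := lt_freqNorm_of_notMem_freqBox hξ
  have hM0 : (0 : ℝ) < M := by exact_mod_cast hM1
  have hpos : 0 < freqNorm ξ := hM0.trans hlt
  have h2 : ‖fourierTransform (mollifier d h K) ξ - 1‖ ≤ 2 := by
    refine (norm_sub_le _ _).trans ?_
    have := norm_fourierTransform_le (mollifier d h K) ξ
    rw [norm_one]; linarith
  have h3 : freqNorm ξ ^ (l / 2) = freqNorm ξ ^ (l' / 2) * freqNorm ξ ^ (-((l' - l) / 2)) := by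
    rw [← Real.rpow_add hpos]; congr 1; ring
  have h4 : freqNorm ξ ^ (-((l' - l) / 2)) ≤ (M : ℝ) ^ (-((l' - l) / 2)) :=
    Real.rpow_le_rpow_of_nonpos hM0 hlt.le (by linarith)
  rw [norm_mul, h3]
  calc _ = ‖fourierTransform (mollifier d h K) ξ - 1‖ *
        (‖fourierTransform μ ξ‖ * freqNorm ξ ^ (l' / 2)) * freqNorm ξ ^ (-((l' - l) / 2)) := by ring
    _ ≤ 2 * C * (M : ℝ) ^ (-((l' - l) / 2)) := by
        gcongr
        exact hμC ξ
    _ ≤ ε := hM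

theorem fourierSeminorm_mollifier_conv_lt_top {d : ℕ} (ρ : Measure (Torus d))
    [IsProbabilityMeasure ρ] {h : ℝ} (hh : 0 < h) {K : ℕ} {l : ℝ} (hl : 0 ≤ l) (hlK : l ≤ 2 * K) :
    fourierSeminorm l (mollifier d h K ∗ ρ) < ∞ := by
  -- The summand `1` covers `ξ = 0`, where the weight is `0 ^ (l / 2)`, equal to `1` when `l = 0`.
  refine lt_of_le_of_lt (weightedSup_le_ofReal (C := 1 + (d / h) ^ K) fun ξ => ?_)
    ENNReal.ofReal_lt_top
  rw [fourierTransform_conv, norm_mul]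
  have h1 := norm_fourierTransform_le ρ ξ
  have h2 := norm_fourierTransform_le (mollifier d h K) ξ
  have h0 : 0 ≤ ((d : ℝ) / h) ^ K := by positivity
  rcases eq_or_ne ξ 0 with rfl | hξ
  · have h3 : (0 : ℝ) ^ (l / 2) ≤ 1 := by
      rcases hl.eq_or_lt with rfl | hl
      · simp
      · rw [Real.zero_rpow (by positivity)]; exact zero_le_one
    rw [freqNorm_zero]
    calc _ ≤ (1 : ℝ) * 1 * 1 := by gcongr
      _ ≤ _ := by linarith
  · have h3 := one_le_freqNorm hξ
    have h4 := norm_fourierTransform_mollifier_mul_le hh K ξ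
    have h5 : freqNorm ξ ^ (l / 2) ≤ freqNorm ξ ^ K := by
      rw [← Real.rpow_natCast]
      exact Real.rpow_le_rpow_of_exponent_le h3 (by linarith)
    have h6 : ‖fourierTransform (mollifier d h K) ξ‖ * freqNorm ξ ^ K ≤ (d / h) ^ K := by
      rw [div_pow, le_div_iff₀ (by positivity)]
      calc _ = ‖fourierTransform (mollifier d h K) ξ‖ * (h * freqNorm ξ) ^ K := by
            rw [mul_pow]; ring
        _ ≤ _ := h4
    calc _ ≤ ‖fourierTransform (mollifier d h K) ξ‖ * 1 * freqNorm ξ ^ K := by gcongr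
      _ ≤ _ := by linarith

theorem eventually_card_mul_exp_lt (d : ℕ) {b l c : ℝ} (hbl : l < b) (hc : 0 < c) :
    ∀ᶠ M : ℕ in atTop, ((2 * M + 1) ^ d : ℝ) * (4 * Real.exp (-(c * (M : ℝ) ^ (b - l)))) < 1 := by
  have hp : 0 < b - l := by linarith
  have h1 : Tendsto (fun M : ℕ => (M : ℝ) ^ (b - l)) atTop atTop :=
    (tendsto_rpow_atTop hp).comp tendsto_natCast_atTop_atTop
  -- In the variable `M ^ (b - l)`, the count `M ^ d` is the power `d / (b - l)`, which loses to the
  -- exponential.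
  have h2 := ((tendsto_rpow_mul_exp_neg_mul_atTop_nhds_zero (d / (b - l)) c hc).comp h1).const_mul
    ((3 : ℝ) ^ d * 4)
  rw [mul_zero] at h2
  filter_upwards [h2.eventually (gt_mem_nhds zero_lt_one), eventually_ge_atTop 1] with M hM hM1
  refine lt_of_le_of_lt ?_ hM
  have hM1' : (1 : ℝ) ≤ M := by exact_mod_cast hM1
  simp only [Function.comp_apply]
  rw [← Real.rpow_mul (by positivity), mul_div_cancel₀ _ hp.ne', Real.rpow_natCast]
  calc _ ≤ ((3 * M : ℝ) ^ d) * (4 * Real.exp (-(c * (M : ℝ) ^ (b - l)))) := by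
        gcongr; linarith
    _ = _ := by rw [mul_pow, neg_mul]; ring

/-! ### Parameters and the approximating measures -/

/-- Choice of the parameters: scale `h`, number of points `N`, frequency cutoff `M`, and
discrepancy `s`. -/
theorem exists_parameters (d : ℕ) (hd : 0 < d) {l t : ℝ} (hl : 0 ≤ l) (hlt : l < t) (B : ℝ) :
    ∃ K : ℕ, B ≤ 2 * K ∧ ∀ ε : ℝ, 0 < ε → ∀ p : ℝ → Prop, (∀ᶠ h in 𝓝[>] 0, p h) →
      ∃ (h : ℝ) (N M : ℕ) (s : ℝ), p h ∧ 0 < h ∧ 0 < N ∧ 0 < M ∧ 0 ≤ s ∧ l / 2 ≤ K ∧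
        2 * s * (d * M) ^ (l / 2) ≤ ε ∧
        2 * (d / h) ^ K * (M : ℝ) ^ (l / 2 - K) ≤ ε ∧
        ((2 * M + 1) ^ d : ℝ) * (4 * Real.exp (-(N * s ^ 2 / 2))) < 1 ∧
        N * h ^ t ≤ ε := by
  have ht : 0 < t := by linarith
  -- Everything is a power of `M`: `h = M ^ (-a)` and `N = ⌈M ^ b⌉` with `l < b < a t` and `a < 1`.
  -- Here `b > l` serves the sampling, `b < a t` the covering sum, and `a < 1` the decay of the
  -- mollifier beyond `M`.
  obtain ⟨a, hla, ha1⟩ := exists_between ((div_lt_one ht).2 hlt)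
  rw [div_lt_iff₀ ht] at hla
  obtain ⟨b, hlb, hba⟩ := exists_between hla
  have ha0 : 0 < a := by
    by_contra! hcon
    nlinarith
  -- The last bound gives `K (1 - a) > l / 2`, so that `(h M) ^ (-K)` beats the weight `M ^ (l /
  -- 2)`. This `K` depends neither on `ε` nor on `h`, so the smoothing condition `p` can be stated
  -- for it in advance.
  obtain ⟨K, hK⟩ := exists_nat_gt (max (B / 2) (max (l / 2) (l / 2 / (1 - a))))
  have hK1 : B / 2 < K := (le_max_left _ _).trans_lt hK
  have hK2 : l / 2 < K := ((le_max_left _ _).trans (le_max_right _ _)).trans_lt hK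
  have hK3 : l / 2 / (1 - a) < K := ((le_max_right _ _).trans (le_max_right _ _)).trans_lt hK
  rw [div_lt_iff₀ (by linarith)] at hK3
  refine ⟨K, by linarith, fun ε hε p hp => ?_⟩
  have hd' : (0 : ℝ) < d := by exact_mod_cast hd
  -- Chosen so that `2 * s * (d * M) ^ (l / 2) = ε`; then `N * s ^ 2` is at least of order `M ^ (b -
  -- l)`.
  let s : ℕ → ℝ := fun M => ε / 2 * (d * M) ^ (-(l / 2))
  have hh : Tendsto (fun M : ℕ => (M : ℝ) ^ (-a)) atTop (𝓝[>] 0) := by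
    refine tendsto_nhdsWithin_iff.2 ⟨tendsto_natCast_rpow_neg ha0, ?_⟩
    filter_upwards [eventually_ge_atTop 1] with M hM
    have : (0 : ℝ) < M := by exact_mod_cast hM
    exact Real.rpow_pos_of_pos this _
  have e1 : ∀ᶠ M : ℕ in atTop, 2 * (d : ℝ) ^ K * (M : ℝ) ^ (-(K * (1 - a) - l / 2)) ≤ ε := by
    have := (tendsto_natCast_rpow_neg (p := K * (1 - a) - l / 2) (by linarith)).const_mul
      (2 * (d : ℝ) ^ K)
    rw [mul_zero] at this
    exact this.eventually (ge_mem_nhds hε)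
  have e2 : ∀ᶠ M : ℕ in atTop, 2 * (M : ℝ) ^ (-(a * t - b)) ≤ ε := by
    have := (tendsto_natCast_rpow_neg (p := a * t - b) (by linarith)).const_mul 2
    rw [mul_zero] at this
    exact this.eventually (ge_mem_nhds hε)
  have e3 := eventually_card_mul_exp_lt d hlb (c := ε ^ 2 / 8 * (d : ℝ) ^ (-l)) (by positivity)
  obtain ⟨M, hpM, h1, h2, h3, hM⟩ :=
    ((hh.eventually hp).and (e1.and (e2.and (e3.and (eventually_ge_atTop 1))))).exists
  have hM1 : (1 : ℝ) ≤ M := by exact_mod_cast hM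
  have hM0 : (0 : ℝ) < M := by linarith
  refine ⟨(M : ℝ) ^ (-a), ⌈(M : ℝ) ^ b⌉₊, M, s M, hpM, by positivity, by positivity, hM,
    by positivity, by linarith, ?_, ?_, ?_, ?_⟩
  · simp only [s]
    rw [Real.rpow_neg (by positivity)]
    field_simp
    exact le_rfl
  · refine le_trans (le_of_eq ?_) h1
    rw [div_pow, ← Real.rpow_natCast ((M : ℝ) ^ (-a)), ← Real.rpow_mul hM0.le,
      div_eq_mul_inv, ← Real.rpow_neg hM0.le, mul_assoc, mul_assoc, ← Real.rpow_add hM0, mul_assoc]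
    congr 3
    ring
  · refine lt_of_le_of_lt ?_ h3
    have hs : s M ^ 2 = ε ^ 2 / 4 * (d : ℝ) ^ (-l) * (M : ℝ) ^ (-l) := by
      simp only [s]
      rw [mul_pow, ← Real.rpow_natCast (_ ^ _) 2, ← Real.rpow_mul (by positivity),
        Real.mul_rpow hd'.le hM0.le]
      have : -(l / 2) * ((2 : ℕ) : ℝ) = -l := by push_cast; ring
      rw [this]; ring
    have : ε ^ 2 / 8 * (d : ℝ) ^ (-l) * (M : ℝ) ^ (b - l) ≤ ⌈(M : ℝ) ^ b⌉₊ * s M ^ 2 / 2 := by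
      rw [hs, sub_eq_add_neg, Real.rpow_add hM0]
      calc _ = (M : ℝ) ^ b * (ε ^ 2 / 4 * (d : ℝ) ^ (-l) * (M : ℝ) ^ (-l)) / 2 := by ring
        _ ≤ _ := by
          gcongr
          exact Nat.le_ceil _
    gcongr
  · refine le_trans ?_ h2
    have hb : (1 : ℝ) ≤ (M : ℝ) ^ b := Real.one_le_rpow hM1 (by linarith)
    have hN : (⌈(M : ℝ) ^ b⌉₊ : ℝ) ≤ 2 * (M : ℝ) ^ b := by
      have := Nat.ceil_lt_add_one (a := (M : ℝ) ^ b) (by positivity)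
      linarith
    rw [← Real.rpow_mul hM0.le]
    calc _ ≤ 2 * (M : ℝ) ^ b * (M : ℝ) ^ (-a * t) := by gcongr
      _ = _ := by
        rw [mul_assoc, ← Real.rpow_add hM0]
        congr 2
        ring

/-- Approximation of a measure by measures concentrated on few small balls. -/
theorem exists_approx {d : ℕ} (hd : 0 < d) {β l t : ℝ} (hl : 0 ≤ l) (hlβ : l < β) (hβt : β < t)
    (μ : Measure (Torus d)) [IsProbabilityMeasure μ]
    (hμ : ∀ l : ℝ, 0 ≤ l → l < β → fourierSeminorm l μ < ∞) {E : Set (Torus d)}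
    (hE : ∀ᵐ x ∂μ, x ∈ E) {ε : ℝ} (hε : 0 < ε) :
    ∃ (N : ℕ) (r : ℝ) (X : Fin N → Torus d) (ν : Measure (Torus d)), 0 < r ∧ r ≤ ε ∧
      N * r ^ t ≤ ε ∧ (∀ j, X j ∈ E) ∧ IsProbabilityMeasure ν ∧
      (∀ᵐ x ∂ν, x ∈ ⋃ j, Metric.closedBall (X j) r) ∧
      (∀ l : ℝ, 0 ≤ l → l < β → fourierSeminorm l ν < ∞) ∧
      fourierSeminormDiff l ν μ ≤ ENNReal.ofReal ε := by
  obtain ⟨l', hll', hl'β⟩ := exists_between hlβ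
  have ht : 0 < t := by linarith
  obtain ⟨K, hβK, hK⟩ := exists_parameters d hd hl (hlβ.trans hβt) β
  have hK0 : (0 : ℝ) < K + 1 := by positivity
  -- One half of `ε` is for sampling and the other for smoothing; the division by `(K + 1) ^ t`
  -- compensates for the ball radius `(K + 1) * h`.
  have hε' : 0 < min (ε / 2) (ε / ((K : ℝ) + 1) ^ t) := by positivity
  have hp : ∀ᶠ h in 𝓝[>] (0 : ℝ), (∀ ξ, ‖(fourierTransform (mollifier d h K) ξ - 1) *
      fourierTransform μ ξ‖ * freqNorm ξ ^ (l / 2) ≤ ε / 2) ∧ h ≤ ε / (K + 1) :=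
    (eventually_mollifier_sub_one_le μ hll' (hμ l' (hl.trans hll'.le) hl'β) K (half_pos hε)).and
      (nhdsWithin_le_nhds (ge_mem_nhds (by positivity)))
  obtain ⟨h, N, M, s, ⟨hsmooth, hhε⟩, hh, hN, hM, hs, hlK, h1, h2, h3, h4⟩ := hK _ hε' _ hp
  have hM0 : (0 : ℝ) < M := by exact_mod_cast hM
  obtain ⟨X, hXE, hX⟩ := exists_sample μ hE (freqBox d M) hN hs
    (by rw [card_freqBox]; exact_mod_cast h3)
  have := isProbabilityMeasure_empirical hN X
  refine ⟨N, (K + 1) * h, X, mollifier d h K ∗ empirical X, by positivity, ?_, ?_, hXE,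
    inferInstance, ?_, fun l hl hlβ => ?_, ?_⟩
  · rwa [le_div_iff₀ hK0, mul_comm] at hhε
  · have := h4.trans (min_le_right _ _)
    rw [le_div_iff₀ (by positivity)] at this
    rw [Real.mul_rpow hK0.le hh.le]
    linarith
  · refine ae_conv_of_forall (norm_le_mollifier d hh.le K) (ae_mem_empirical X)
      (isClosed_iUnion_of_finite fun _ => Metric.isClosed_closedBall).measurableSet ?_
    rintro x hx _ ⟨j, rfl⟩
    refine Set.mem_iUnion.2 ⟨j, ?_⟩
    rw [mem_closedBall_iff_norm, add_sub_cancel_right]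
    have hx' : ‖x‖ ≤ K * h := hx
    linarith
  · exact fourierSeminorm_mollifier_conv_lt_top _ hh hl (by linarith)
  · refine weightedSup_le_ofReal fun ξ => ?_
    rw [fourierTransform_conv, fourierTransform_empirical]
    have hD : ‖(N : ℂ)⁻¹ * ∑ j, UnitAddTorus.mFourier (-ξ) (X j)‖ ≤ 1 := by
      rw [← fourierTransform_empirical]; exact norm_fourierTransform_le _ _
    set D : ℂ := (N : ℂ)⁻¹ * ∑ j, UnitAddTorus.mFourier (-ξ) (X j) - fourierTransform μ ξ with hDdef
    have hφ := norm_fourierTransform_le (mollifier d h K) ξ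
    have hfq : 0 ≤ freqNorm ξ ^ (l / 2) := Real.rpow_nonneg (freqNorm_nonneg ξ) _
    -- Inside the box the sampling bound on `D` is used; outside, only `‖D‖ ≤ 2` and the decay of
    -- the mollifier.
    have key : ‖fourierTransform (mollifier d h K) ξ * D‖ * freqNorm ξ ^ (l / 2) ≤ ε / 2 := by
      refine le_trans ?_ (min_le_left _ (ε / ((K : ℝ) + 1) ^ t))
      rw [norm_mul]
      by_cases hξ : ξ ∈ freqBox d M
      · refine le_trans ?_ h1
        have hDs := hX ξ hξ
        calc _ ≤ 1 * (2 * s) * (d * M : ℝ) ^ (l / 2) := by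
              gcongr
              · exact freqNorm_nonneg ξ
              · exact freqNorm_le_of_mem_freqBox hξ
          _ = _ := by ring
      · refine le_trans ?_ h2
        have hlt := lt_freqNorm_of_notMem_freqBox hξ
        have hpos : 0 < freqNorm ξ := hM0.trans hlt
        have hD2 : ‖D‖ ≤ 2 := by
          refine (norm_sub_le _ _).trans ?_
          linarith [norm_fourierTransform_le μ ξ]
        have h5 : ‖fourierTransform (mollifier d h K) ξ‖ ≤ (d / h) ^ K * freqNorm ξ ^ (-(K : ℝ)) := by
          rw [Real.rpow_neg hpos.le, Real.rpow_natCast, ← div_eq_mul_inv, le_div_iff₀ (by positivity),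
            div_pow, le_div_iff₀ (by positivity)]
          calc _ = ‖fourierTransform (mollifier d h K) ξ‖ * (h * freqNorm ξ) ^ K := by
                rw [mul_pow]; ring
            _ ≤ _ := norm_fourierTransform_mollifier_mul_le hh K ξ
        calc _ ≤ (d / h) ^ K * freqNorm ξ ^ (-(K : ℝ)) * 2 * freqNorm ξ ^ (l / 2) := by gcongr
          _ = 2 * (d / h) ^ K * freqNorm ξ ^ (l / 2 - K) := by
            rw [sub_eq_neg_add, Real.rpow_add hpos]; ring
          _ ≤ _ := mul_le_mul_of_nonneg_left
            (Real.rpow_le_rpow_of_nonpos hM0 hlt.le (by linarith)) (by positivity)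
    have hsplit : fourierTransform (mollifier d h K) ξ *
        ((N : ℂ)⁻¹ * ∑ j, UnitAddTorus.mFourier (-ξ) (X j)) - fourierTransform μ ξ =
        fourierTransform (mollifier d h K) ξ * D +
          (fourierTransform (mollifier d h K) ξ - 1) * fourierTransform μ ξ := by
      rw [hDdef]; ring
    rw [hsplit]
    calc _ ≤ (‖fourierTransform (mollifier d h K) ξ * D‖ +
          ‖(fourierTransform (mollifier d h K) ξ - 1) * fourierTransform μ ξ‖) *
            freqNorm ξ ^ (l / 2) := by gcongr; exact norm_add_le _ _
      _ ≤ ε := by rw [add_mul]; linarith [hsmooth ξ]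

/-! ### Small covers and Hausdorff dimension -/

/-- `K` is covered by finitely many balls of radii `r i ≤ δ` with `∑ (2 r i)^t ≤ δ`. -/
def HasSmallCover {X : Type*} [PseudoMetricSpace X] (t δ : ℝ) (K : Set X) : Prop :=
  ∃ (ι : Type) (_ : Fintype ι) (x : ι → X) (r : ι → ℝ), (∀ i, 0 ≤ r i ∧ r i ≤ δ) ∧
    ∑ i, (2 * r i) ^ t ≤ δ ∧ K ⊆ ⋃ i, Metric.ball (x i) (r i)

/-- The balls are open, so the same cover works for every compact set close enough to `K`. -/
theorem isOpen_setOf_hasSmallCover {X : Type*} [MetricSpace X] (t δ : ℝ) :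
    IsOpen {K : Compacts X | HasSmallCover t δ (K : Set X)} := by
  rw [isOpen_iff_mem_nhds]
  rintro K ⟨ι, hι, x, r, h1, h2, h3⟩
  filter_upwards [(Compacts.isOpen_subsets_of_isOpen
    (isOpen_iUnion fun i => Metric.isOpen_ball (x := x i) (ε := r i))).mem_nhds h3] with L hL
  exact ⟨ι, hι, x, r, h1, h2, hL⟩

theorem HasSmallCover.union {X : Type*} [PseudoMetricSpace X] {t δ δ' η : ℝ} {K L : Set X}
    (hK : HasSmallCover t δ K) (hL : HasSmallCover t δ' L) (hδ : 0 ≤ δ) (hδ' : 0 ≤ δ')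
    (h : δ + δ' ≤ η) : HasSmallCover t η (K ∪ L) := by
  obtain ⟨ι, hι, x, r, h1, h2, h3⟩ := hK
  obtain ⟨ι', hι', x', r', h1', h2', h3'⟩ := hL
  refine ⟨ι ⊕ ι', inferInstance, Sum.elim x x', Sum.elim r r', ?_, ?_, ?_⟩
  · rintro (i | i)
    · exact ⟨(h1 i).1, by simp only [Sum.elim_inl]; linarith [(h1 i).2]⟩
    · exact ⟨(h1' i).1, by simp only [Sum.elim_inr]; linarith [(h1' i).2]⟩
  · rw [Fintype.sum_sum_type]
    simp only [Sum.elim_inl, Sum.elim_inr]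
    linarith
  · rw [Set.iUnion_sum]
    exact Set.union_subset_union h3 h3'

theorem hasSmallCover_of_finite {X : Type} [PseudoMetricSpace X] {t δ : ℝ} (ht : 0 < t)
    (hδ : 0 < δ) {F : Set X} (hF : F.Finite) : HasSmallCover t δ F := by
  have hlim : Tendsto (fun r : ℝ => (hF.toFinset.card : ℝ) * (2 * r) ^ t) (𝓝[>] 0) (𝓝 0) := by
    have h1 : ContinuousAt (fun r : ℝ => (hF.toFinset.card : ℝ) * (2 * r) ^ t) 0 :=
      ContinuousAt.mul continuousAt_const
        (ContinuousAt.rpow_const (by fun_prop) (Or.inr ht.le))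
    have h2 := h1.tendsto
    simp only [mul_zero, Real.zero_rpow ht.ne'] at h2
    exact h2.mono_left nhdsWithin_le_nhds
  obtain ⟨r, h1, h2, h3⟩ := ((hlim.eventually (ge_mem_nhds hδ)).and
    ((eventually_nhdsWithin_of_eventually_nhds (ge_mem_nhds hδ)).and self_mem_nhdsWithin)).exists
  have h3 : 0 < r := h3
  refine ⟨hF.toFinset, inferInstance, fun x => x, fun _ => r, fun _ => ⟨h3.le, h2⟩, ?_, ?_⟩
  · simpa using h1
  · intro x hx
    exact Set.mem_iUnion.2 ⟨⟨x, by simpa using hx⟩, Metric.mem_ball_self h3⟩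

theorem dimH_le_of_hasSmallCover {X : Type*} [MetricSpace X] {t : ℝ} (ht : 0 < t) {K : Set X}
    (h : ∀ n : ℕ, HasSmallCover t (1 / ((n : ℝ) + 1)) K) : dimH K ≤ ENNReal.ofReal t := by
  borelize X
  choose ι hι x r h1 h2 h3 using h
  have hz : Tendsto (fun n : ℕ => ENNReal.ofReal (1 / ((n : ℝ) + 1))) atTop (𝓝 0) := by
    have := ENNReal.tendsto_ofReal (tendsto_one_div_add_atTop_nhds_zero_nat (𝕜 := ℝ))
    rwa [ENNReal.ofReal_zero] at this
  have hz2 : Tendsto (fun n : ℕ => 2 * ENNReal.ofReal (1 / ((n : ℝ) + 1))) atTop (𝓝 0) := by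
    simpa using ENNReal.Tendsto.const_mul (a := 2) hz (Or.inr (by simp))
  have hd : ∀ n i, Metric.ediam (Metric.ball (x n i) (r n i)) ≤ ENNReal.ofReal (2 * r n i) := by
    intro n i
    rw [← Metric.eball_ofReal, ENNReal.ofReal_mul two_pos.le, ENNReal.ofReal_ofNat]
    exact Metric.ediam_eball_le
  have hm : μH[t] K ≤ liminf (fun n => ∑ i, Metric.ediam (Metric.ball (x n i) (r n i)) ^ t) atTop := by
    refine Measure.hausdorffMeasure_le_liminf_sum t K _ hz2 (fun n i => Metric.ball (x n i) (r n i))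
      (Eventually.of_forall fun n i => (hd n i).trans ?_) (Eventually.of_forall h3)
    rw [ENNReal.ofReal_mul two_pos.le, ENNReal.ofReal_ofNat]
    gcongr
    exact (h1 n i).2
  have hle : ∀ n, ∑ i, Metric.ediam (Metric.ball (x n i) (r n i)) ^ t ≤
      ENNReal.ofReal (1 / ((n : ℝ) + 1)) := by
    intro n
    calc _ ≤ ∑ i, ENNReal.ofReal ((2 * r n i) ^ t) := by
          refine Finset.sum_le_sum fun i _ => ?_
          rw [← ENNReal.ofReal_rpow_of_nonneg (by linarith [(h1 n i).1]) ht.le]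
          exact ENNReal.rpow_le_rpow (hd n i) ht.le
      _ = ENNReal.ofReal (∑ i, (2 * r n i) ^ t) :=
          (ENNReal.ofReal_sum_of_nonneg fun i _ =>
            Real.rpow_nonneg (by linarith [(h1 n i).1]) _).symm
      _ ≤ _ := ENNReal.ofReal_le_ofReal (h2 n)
  have h0 : μH[t] K = 0 := by
    refine le_antisymm (hm.trans ?_) zero_le
    refine (liminf_le_liminf (Eventually.of_forall hle)).trans ?_
    rw [hz.liminf_eq]
  have h00 : μH[t.toNNReal] K = 0 := by rwa [Real.coe_toNNReal _ ht.le]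
  exact dimH_le_of_hausdorffMeasure_ne_top (by rw [h00]; simp)

/-! ### Density of small covers and the generic upper bound -/

/-- Nonzero frequencies have norm at least `1`. At `ξ = 0` the weights need not be monotone, but two
probability measures have the same transform there. -/
theorem fourierSeminormDiff_mono {d : ℕ} {l l' : ℝ} (hll' : l ≤ l')
    (μ ν : Measure (Torus d)) [IsProbabilityMeasure μ] [IsProbabilityMeasure ν] :
    fourierSeminormDiff l μ ν ≤ fourierSeminormDiff l' μ ν := by
  refine iSup_le fun ξ => le_trans ?_
    (le_iSup (fun ξ => ‖fourierTransform μ ξ - fourierTransform ν ξ‖ₑ *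
      ENNReal.ofReal (freqNorm ξ ^ (l' / 2))) ξ)
  rcases eq_or_ne ξ 0 with rfl | hξ
  · simp [fourierTransform_zero]
  · gcongr
    exact one_le_freqNorm hξ

theorem ae_mem_of_mem_XSpace {d : ℕ} {β : ℝ} {p : Compacts (Torus d) × MSpace d β}
    (hp : p ∈ XSpace d β) : ∀ᵐ x ∂p.2.1, x ∈ (p.1 : Set (Torus d)) := by
  filter_upwards [Measure.support_mem_ae (μ := p.2.1)] with x hx using hp.2 hx

theorem exists_XSpace_near {d : ℕ} (hd : 0 < d) {β l t δ : ℝ} (hl : 0 ≤ l) (hlβ : l < β)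
    (hβt : β < t) (hδ : 0 < δ) (p : XSpace d β) {ε : ℝ} (hε : 0 < ε) :
    ∃ q : XSpace d β, HasSmallCover t δ (q.1.1 : Set (Torus d)) ∧
      edist q.1.1 p.1.1 ≤ ENNReal.ofReal ε ∧
      fourierSeminormDiff l q.1.2.1 p.1.2.1 ≤ ENNReal.ofReal ε := by
  obtain ⟨⟨E, μ, hμfin, hμ⟩, hp⟩ := p
  have hμp : IsProbabilityMeasure μ := hp.1
  have ht : 0 < t := by linarith
  -- The closed balls of radius `r` are covered by open balls of radius `2 r`: `δ / 4` ensures `2 r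
  -- ≤ δ / 2`, and the last term bounds `N * (4 r) ^ t` by `δ / 2`. The other half of `δ` is for the
  -- net.
  have hη : 0 < min ε (min (δ / 4) (δ / 2 / 4 ^ t)) := by positivity
  obtain ⟨N, r, X, ν, hr, hrη, hNr, hXE, hνp, hνX, hν, hdiff⟩ :=
    exists_approx hd hl hlβ hβt μ hμ (ae_mem_of_mem_XSpace hp) hη
  set η := min ε (min (δ / 4) (δ / 2 / 4 ^ t)) with hηdef
  have hηε : η ≤ ε := min_le_left _ _
  have hη1 : η ≤ δ / 4 := (min_le_right _ _).trans (min_le_left _ _)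
  have hη2 : η ≤ δ / 2 / 4 ^ t := (min_le_right _ _).trans (min_le_right _ _)
  rw [le_div_iff₀ (by positivity)] at hη2
  obtain ⟨F, hFE, hFfin, hEF⟩ := finite_cover_balls_of_compact E.isCompact hε
  have hcpt : IsCompact ((⋃ j, Metric.closedBall (X j) r) ∪ F) :=
    (isCompact_iUnion fun j => isCompact_closedBall (X j) r).union hFfin.isCompact
  refine ⟨⟨⟨⟨_, hcpt⟩, ν, inferInstance, hν⟩, hνp, ?_⟩, ?_, ?_, ?_⟩
  · refine Measure.support_subset_of_isClosed hcpt.isClosed ?_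
    filter_upwards [hνX] with x hx using Or.inl hx
  · refine HasSmallCover.union (δ := δ / 2) (δ' := δ / 2) ?_
      (hasSmallCover_of_finite ht (half_pos hδ) hFfin) (by positivity) (by positivity) (by linarith)
    refine ⟨Fin N, inferInstance, X, fun _ => 2 * r, fun _ => ⟨by positivity, by linarith⟩, ?_, ?_⟩
    · have h4 : (2 * (2 * r)) ^ t = 4 ^ t * r ^ t := by
        rw [← Real.mul_rpow (by norm_num) hr.le]; congr 1; ring
      simp only [Finset.sum_const, Finset.card_univ, Fintype.card_fin, nsmul_eq_mul]
      rw [h4]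
      have : (0 : ℝ) < 4 ^ t := by positivity
      nlinarith
    · exact Set.iUnion_mono fun j => Metric.closedBall_subset_ball (by linarith)
  · rw [Compacts.edist_eq]
    refine Metric.hausdorffEDist_le_of_mem_edist ?_ ?_
    · rintro x (hx | hx)
      · obtain ⟨j, hj⟩ := Set.mem_iUnion.1 hx
        refine ⟨X j, hXE j, ?_⟩
        rw [edist_dist]
        exact ENNReal.ofReal_le_ofReal ((Metric.mem_closedBall.1 hj).trans (hrη.trans hηε))
      · exact ⟨x, hFE hx, by simp⟩
    · intro x hx
      obtain ⟨y, hy, hxy⟩ := Set.mem_iUnion₂.1 (hEF hx)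
      refine ⟨y, Or.inr hy, ?_⟩
      rw [edist_dist]
      exact ENNReal.ofReal_le_ofReal (Metric.mem_ball.1 hxy).le
  · exact hdiff.trans (ENNReal.ofReal_le_ofReal hηε)

theorem dense_setOf_hasSmallCover {d : ℕ} (hd : 0 < d) {β t δ : ℝ} (hβ : 0 < β)
    (hβt : β < t) (hδ : 0 < δ) :
    Dense {p : XSpace d β | HasSmallCover t δ (p.1.1 : Set (Torus d))} := by
  intro p
  -- Exponents increasing to `β`: by monotonicity, a single sequence converges in all the seminorms
  -- at once.
  let l : ℕ → ℝ := fun n => β - β * (1 / ((n : ℝ) + 1))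
  have hinv : Tendsto (fun n : ℕ => 1 / ((n : ℝ) + 1)) atTop (𝓝 0) :=
    tendsto_one_div_add_atTop_nhds_zero_nat
  have hl : Tendsto l atTop (𝓝 β) := by
    simpa [l] using (hinv.const_mul β).const_sub β
  have hl0 : ∀ n, 0 ≤ l n := fun n => by
    have : 1 / ((n : ℝ) + 1) ≤ 1 := by
      rw [div_le_one (by positivity)]; linarith [n.cast_nonneg (α := ℝ)]
    simp only [l]; nlinarith
  have hlβ : ∀ n, l n < β := fun n => by
    have : 0 < β * (1 / ((n : ℝ) + 1)) := by positivity
    simp only [l]; linarith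
  choose q hq1 hq2 hq3 using fun n : ℕ =>
    exists_XSpace_near hd (hl0 n) (hlβ n) hβt hδ p (ε := 1 / ((n : ℝ) + 1)) (by positivity)
  have hz : Tendsto (fun n : ℕ => ENNReal.ofReal (1 / ((n : ℝ) + 1))) atTop (𝓝 0) := by
    have := ENNReal.tendsto_ofReal hinv
    rwa [ENNReal.ofReal_zero] at this
  refine mem_closure_of_tendsto (f := q) (b := atTop) ?_ (Eventually.of_forall hq1)
  rw [tendsto_subtype_rng, Prod.tendsto_iff]
  constructor
  · exact tendsto_iff_edist_tendsto_0.2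
      (tendsto_of_tendsto_of_tendsto_of_le_of_le tendsto_const_nhds hz (fun _ => zero_le) hq2)
  · refine (MSpace.tendsto_iff _ _ _).2 fun l' hl' hl'β => ?_
    refine tendsto_of_tendsto_of_tendsto_of_le_of_le' tendsto_const_nhds hz
      (Eventually.of_forall fun _ => zero_le) ?_
    filter_upwards [hl.eventually (le_mem_nhds hl'β)] with n hn
    have h1 : IsProbabilityMeasure (q n).1.2.1 := (q n).2.1
    have h2 : IsProbabilityMeasure p.1.2.1 := p.2.1
    exact (fourierSeminormDiff_mono hn _ _).trans (hq3 n)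

theorem eventually_residual_dimH_le {d : ℕ} (hd : 0 < d) {β : ℝ} (hβ : 0 < β) :
    ∀ᶠ p : XSpace d β in residual (XSpace d β),
      dimH (p.1.1 : Set (Torus d)) ≤ ENNReal.ofReal β := by
  have h : ∀ᶠ p : XSpace d β in residual (XSpace d β), ∀ m n : ℕ,
      HasSmallCover (β + 1 / ((m : ℝ) + 1)) (1 / ((n : ℝ) + 1)) (p.1.1 : Set (Torus d)) := by
    rw [eventually_countable_forall]
    intro m
    rw [eventually_countable_forall]
    intro n
    have hm : β < β + 1 / ((m : ℝ) + 1) := by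
      have : 0 < 1 / ((m : ℝ) + 1) := by positivity
      linarith
    exact residual_of_dense_open
      ((isOpen_setOf_hasSmallCover _ _).preimage (continuous_fst.comp continuous_subtype_val))
      (dense_setOf_hasSmallCover hd hβ hm (by positivity))
  filter_upwards [h] with p hp
  have hlim : Tendsto (fun m : ℕ => ENNReal.ofReal (β + 1 / ((m : ℝ) + 1))) atTop
      (𝓝 (ENNReal.ofReal β)) := by
    have := (tendsto_one_div_add_atTop_nhds_zero_nat (𝕜 := ℝ)).const_add β
    rw [add_zero] at this
    exact ENNReal.tendsto_ofReal this
  exact ge_of_tendsto' hlim fun m => dimH_le_of_hasSmallCover (by positivity) (hp m)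

/-! ### From correlation bounds to Hausdorff dimension -/

/-- Mass distribution principle: an upper bound on ball masses on a set of positive measure bounds
the Hausdorff dimension from below. -/
theorem le_dimH_of_measure_closedBall_le {X : Type*} [MetricSpace X] [MeasurableSpace X]
    [BorelSpace X] (μ : Measure X) {t : ℝ} (ht : 0 < t) {A E : Set X} (hA : MeasurableSet A)
    {n : ℝ≥0∞} (hn : n ≠ ∞)
    (h : ∀ x ∈ A, ∀ k : ℕ, μ (Metric.closedBall x (1 / (6 * 2 ^ k))) ≤
      n * ENNReal.ofReal ((2 ^ k : ℝ) ^ (-t)))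
    (hAE : μ (A ∩ E) ≠ 0) : ENNReal.ofReal t ≤ dimH E := by
  -- For a set of diameter `D > 0`, taking `2 ^ k ≤ 1 / (6 D) < 2 ^ (k + 1)` gives `2 ^ (-k) < 12
  -- D`. Using `n + 1` keeps `c` nonzero when `n = 0`.
  let c : ℝ≥0∞ := (n + 1) * ENNReal.ofReal (12 ^ t)
  have hc0 : c ≠ 0 := by
    have : (0 : ℝ) < 12 ^ t := by positivity
    simp [c, this]
  have hct : c ≠ ∞ := ENNReal.mul_ne_top (by simpa using hn) ENNReal.ofReal_ne_top
  have hle : c⁻¹ • μ.restrict A ≤ μH[t] := by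
    refine Measure.le_hausdorffMeasure t _ (ENNReal.ofReal (1 / 12)) (by simp) fun U hU => ?_
    rw [Measure.smul_apply, Measure.restrict_apply' hA, smul_eq_mul,
      ENNReal.inv_mul_le_iff hc0 hct]
    rcases (U ∩ A).eq_empty_or_nonempty with he | ⟨x, hxU, hxA⟩
    · simp [he]
    have hfin : Metric.ediam U ≠ ∞ := ne_top_of_le_ne_top ENNReal.ofReal_ne_top hU
    set D : ℝ := (Metric.ediam U).toReal with hD
    have hDU : ENNReal.ofReal D = Metric.ediam U := ENNReal.ofReal_toReal hfin
    have hsub : U ⊆ Metric.closedBall x D := by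
      intro y hy
      rw [Metric.mem_closedBall, ← ENNReal.ofReal_le_ofReal_iff ENNReal.toReal_nonneg, ← edist_dist,
        hDU]
      exact Metric.edist_le_ediam_of_mem hy hxU
    have hD0 : 0 ≤ D := ENNReal.toReal_nonneg
    have hD1 : D ≤ 1 / 12 := by
      rwa [← ENNReal.ofReal_le_ofReal_iff (by norm_num), hDU]
    have hUA : ∀ k : ℕ, D ≤ 1 / (6 * 2 ^ k) →
        μ (U ∩ A) ≤ n * ENNReal.ofReal ((2 ^ k : ℝ) ^ (-t)) := fun k hk =>
      (measure_mono (Set.inter_subset_left.trans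
        (hsub.trans (Metric.closedBall_subset_closedBall hk)))).trans (h x hxA k)
    rcases hD0.eq_or_lt with h0 | hpos
    · have hlim : Tendsto (fun k : ℕ => n * ENNReal.ofReal ((2 ^ k : ℝ) ^ (-t))) atTop (𝓝 0) := by
        have h1 : Tendsto (fun k : ℕ => (2 ^ k : ℝ) ^ (-t)) atTop (𝓝 0) :=
          (tendsto_rpow_neg_atTop ht).comp (tendsto_pow_atTop_atTop_of_one_lt one_lt_two)
        have h2 := ENNReal.Tendsto.const_mul (a := n) (ENNReal.tendsto_ofReal h1) (Or.inr hn)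
        rwa [ENNReal.ofReal_zero, mul_zero] at h2
      have : μ (U ∩ A) ≤ 0 := ge_of_tendsto' hlim fun k => hUA k (by rw [← h0]; positivity)
      exact this.trans zero_le
    · obtain ⟨k, hk1, hk2⟩ := exists_nat_pow_near (x := 1 / (6 * D)) (y := (2 : ℝ))
        (by rw [le_div_iff₀ (by positivity)]; linarith) one_lt_two
      rw [le_div_iff₀ (by positivity)] at hk1
      rw [div_lt_iff₀ (by positivity)] at hk2
      refine (hUA k (by rw [le_div_iff₀ (by positivity)]; linarith)).trans ?_
      rw [← hDU, ENNReal.ofReal_rpow_of_pos hpos, mul_assoc, ← ENNReal.ofReal_mul (by positivity),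
        ← Real.mul_rpow (by norm_num) hpos.le]
      have h2k : (0 : ℝ) < 2 ^ k := by positivity
      have : (2 ^ k : ℝ) ^ (-t) ≤ (12 * D) ^ t := by
        rw [Real.rpow_neg h2k.le, ← Real.inv_rpow h2k.le]
        refine Real.rpow_le_rpow (by positivity) ?_ ht.le
        rw [inv_le_iff_one_le_mul₀ h2k]
        rw [pow_succ] at hk2
        linarith
      gcongr
      exact le_self_add
  have hpos : μH[t] E ≠ 0 := by
    intro h0
    have h1 := (hle E).trans h0.le
    rw [Measure.smul_apply, Measure.restrict_apply' hA, smul_eq_mul, nonpos_iff_eq_zero,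
      mul_eq_zero] at h1
    rcases h1 with h1 | h1
    · exact hct (ENNReal.inv_eq_zero.1 h1)
    · exact hAE (by rwa [Set.inter_comm])
  have := le_dimH_of_hausdorffMeasure_ne_zero (s := E) (d := t.toNNReal)
    (by rwa [Real.coe_toNNReal _ ht.le])
  exact this

/-- By Fubini the hypothesis bounds the `μ`-average of the ball masses at scale `2 ^ (-k)`. Weighted
by `2 ^ (k t)` with `t < t'`, these averages are summable, so the weighted sum `g` is finite almost
everywhere. Some level set `{g ≤ n}` has positive measure, and on it the mass distribution principle
applies. -/
theorem le_dimH_of_prod_dist_le {X : Type*} [MetricSpace X] [SecondCountableTopology X]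
    [MeasurableSpace X] [BorelSpace X] (μ : Measure X) [IsProbabilityMeasure μ] {C t t' : ℝ}
    (ht : 0 < t) (htt' : t < t')
    (h : ∀ k : ℕ, (μ.prod μ) {p | dist p.1 p.2 ≤ 1 / (6 * 2 ^ k)} ≤
      ENNReal.ofReal (C * (2 ^ k : ℝ) ^ (-t')))
    {E : Set X} (hE : ∀ᵐ x ∂μ, x ∈ E) : ENNReal.ofReal t ≤ dimH E := by
  let φ : ℕ → X → ℝ≥0∞ := fun k x => μ (Metric.closedBall x (1 / (6 * 2 ^ k)))
  have hset : ∀ k : ℕ, MeasurableSet {p : X × X | dist p.1 p.2 ≤ 1 / (6 * 2 ^ k)} := fun k =>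
    (isClosed_le continuous_dist continuous_const).measurableSet
  have hpre : ∀ (k : ℕ) (x : X), Prod.mk x ⁻¹' {p : X × X | dist p.1 p.2 ≤ 1 / (6 * 2 ^ k)} =
      Metric.closedBall x (1 / (6 * 2 ^ k)) := by
    intro k x; ext y; simp [dist_comm]
  have hφm : ∀ k, Measurable (φ k) := by
    intro k
    have := measurable_measure_prodMk_left (ν := μ) (hset k)
    simpa only [hpre] using this
  have hφi : ∀ k, ∫⁻ x, φ k x ∂μ ≤ ENNReal.ofReal (C * (2 ^ k : ℝ) ^ (-t')) := by
    intro k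
    refine le_trans (le_of_eq ?_) (h k)
    rw [Measure.prod_apply (hset k)]
    simp only [hpre, φ]
  let w : ℕ → ℝ≥0∞ := fun k => ENNReal.ofReal ((2 ^ k : ℝ) ^ t)
  let g : X → ℝ≥0∞ := fun x => ∑' k, w k * φ k x
  have hgm : Measurable g := Measurable.tsum fun k => (hφm k).const_mul _
  have hpow : ∀ (k : ℕ) (u : ℝ), (2 ^ k : ℝ) ^ u = ((2 : ℝ) ^ u) ^ k := by
    intro k u
    rw [← Real.rpow_natCast, ← Real.rpow_natCast, ← Real.rpow_mul (by norm_num),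
      ← Real.rpow_mul (by norm_num), mul_comm]
  have hgi : ∫⁻ x, g x ∂μ ≠ ∞ := by
    rw [lintegral_tsum fun k => ((hφm k).const_mul _).aemeasurable]
    have hle : ∀ k, ∫⁻ x, w k * φ k x ∂μ ≤ ENNReal.ofReal (C * ((2 : ℝ) ^ (t - t')) ^ k) := by
      intro k
      rw [lintegral_const_mul _ (hφm k)]
      refine (mul_le_mul_right (hφi k) _).trans (le_of_eq ?_)
      rw [← ENNReal.ofReal_mul (by positivity), ← hpow, sub_eq_add_neg,
        Real.rpow_add (by positivity)]
      congr 1; ring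
    refine ne_top_of_le_ne_top ?_ (ENNReal.tsum_le_tsum hle)
    have hs : Summable fun k : ℕ => C * ((2 : ℝ) ^ (t - t')) ^ k :=
      (summable_geometric_of_lt_one (by positivity)
        (Real.rpow_lt_one_of_one_lt_of_neg one_lt_two (by linarith))).mul_left C
    exact hs.tsum_ofReal_ne_top
  have hgf : ∀ᵐ x ∂μ, g x < ∞ := ae_lt_top hgm hgi
  obtain ⟨n, hn⟩ : ∃ n : ℕ, μ {x | g x ≤ n} ≠ 0 := by
    by_contra! hcon
    have h1 : ∀ᵐ x ∂μ, ∀ n : ℕ, ¬ g x ≤ n := by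
      rw [eventually_countable_forall]
      intro n
      rw [ae_iff]
      simpa using hcon n
    have h2 : ∀ᵐ x ∂μ, False := by
      filter_upwards [h1, hgf] with x hx1 hx2
      obtain ⟨n, hn⟩ := ENNReal.exists_nat_gt hx2.ne
      exact hx1 n hn.le
    rw [eventually_false_iff_eq_bot, ae_eq_bot] at h2
    exact IsProbabilityMeasure.ne_zero μ h2
  refine le_dimH_of_measure_closedBall_le μ ht (A := {x | g x ≤ n}) (n := n)
    (measurableSet_le hgm measurable_const) (by simp) (fun x hx k => ?_) ?_
  · have h1 : w k * φ k x ≤ n := (ENNReal.le_tsum k).trans hx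
    have h2k : (0 : ℝ) < 2 ^ k := by positivity
    have h3 : ENNReal.ofReal ((2 ^ k : ℝ) ^ (-t)) * w k = 1 := by
      rw [← ENNReal.ofReal_mul (by positivity), ← Real.rpow_add h2k]
      simp
    calc φ k x = ENNReal.ofReal ((2 ^ k : ℝ) ^ (-t)) * (w k * φ k x) := by
          rw [← mul_assoc, h3, one_mul]
      _ ≤ ENNReal.ofReal ((2 ^ k : ℝ) ^ (-t)) * n := by gcongr
      _ = _ := mul_comm _ _
  · have : μ ({x | g x ≤ n} ∩ E) = μ {x | g x ≤ n} := by
      refine measure_congr ?_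
      filter_upwards [hE] with x hx
      exact propext ⟨fun h => h.1, fun h => ⟨h, hx⟩⟩
    rwa [this]

/-! ### Dirichlet kernels and the correlation integral -/

theorem exists_coe_abs_eq_norm (x : UnitAddCircle) : ∃ y : ℝ, (y : UnitAddCircle) = x ∧ |y| = ‖x‖ := by
  induction x using QuotientAddGroup.induction_on with
  | H z =>
    refine ⟨z - round z, ?_, (UnitAddCircle.norm_eq (x := z)).symm⟩
    rw [AddCircle.coe_sub]
    simp

/-- The one-dimensional Dirichlet sum is large near `0`. -/
theorem le_norm_sum_fourier {N : ℕ} {x : UnitAddCircle} (hx : ‖x‖ ≤ 1 / (6 * N)) :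
    (N / 2 : ℝ) ≤ ‖∑ j ∈ Finset.Ico (0 : ℤ) N, fourier j x‖ := by
  obtain ⟨y, rfl, hy⟩ := exists_coe_abs_eq_norm x
  rw [← hy] at hx
  refine le_trans ?_ (Complex.re_le_norm _)
  rw [Complex.re_sum]
  have hcard : (Finset.Ico (0 : ℤ) N).card • (1 / 2 : ℝ) = N / 2 := by
    simp; ring
  rw [← hcard]
  refine Finset.card_nsmul_le_sum _ _ _ fun j hj => ?_
  rw [Finset.mem_Ico] at hj
  have hj0 : (0 : ℝ) ≤ j := by exact_mod_cast hj.1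
  have hjN : (j : ℝ) ≤ N := by exact_mod_cast hj.2.le
  have hN : (0 : ℝ) < N := by
    have : (0 : ℤ) < N := lt_of_le_of_lt hj.1 hj.2
    exact_mod_cast this
  have h1 : (fourier j (y : UnitAddCircle)).re = Real.cos (2 * Real.pi * j * y) := by
    rw [fourier_coe_apply]
    have : (2 * Real.pi * Complex.I * j * y / (1 : ℝ) : ℂ) =
        ((2 * Real.pi * j * y : ℝ) : ℂ) * Complex.I := by push_cast; ring
    rw [this, Complex.exp_ofReal_mul_I_re]
  -- All phases are at most `2πN / (6N) = π / 3` in absolute value, so each real part is at least `1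
  -- / 2`.
  rw [h1, ← Real.cos_abs, ← Real.cos_pi_div_three]
  refine Real.cos_le_cos_of_nonneg_of_le_pi (abs_nonneg _) (by linarith [Real.pi_pos]) ?_
  rw [abs_mul, abs_of_nonneg (by positivity)]
  calc _ ≤ 2 * Real.pi * N * (1 / (6 * N)) := by gcongr
    _ = _ := by field_simp; norm_num

/-- The `d`-dimensional Dirichlet kernel on `{0, …, N-1}^d`. -/
def dirichletKernel (d N : ℕ) (x : Torus d) : ℂ :=
  ∑ j ∈ Fintype.piFinset fun _ : Fin d => Finset.Ico (0 : ℤ) N, UnitAddTorus.mFourier j x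

theorem continuous_dirichletKernel (d N : ℕ) : Continuous (dirichletKernel d N) :=
  continuous_finsetSum _ fun j _ => (UnitAddTorus.mFourier j).continuous

theorem le_norm_dirichletKernel {d N : ℕ} {x : Torus d} (hx : ‖x‖ ≤ 1 / (6 * N)) :
    (N / 2 : ℝ) ^ d ≤ ‖dirichletKernel d N x‖ := by
  have h : dirichletKernel d N x = ∏ i, ∑ j ∈ Finset.Ico (0 : ℤ) N, fourier j (x i) :=
    Finset.sum_prod_piFinset (Finset.Ico (0 : ℤ) N) fun i j => fourier j (x i)
  rw [h, norm_prod]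
  calc (N / 2 : ℝ) ^ d = ∏ _i : Fin d, (N / 2 : ℝ) := by
        rw [Finset.prod_const, Finset.card_univ, Fintype.card_fin]
    _ ≤ _ := Finset.prod_le_prod (fun _ _ => by positivity) fun i _ =>
      le_norm_sum_fourier ((norm_le_pi_norm x i).trans hx)

theorem integral_normSq_dirichletKernel_le {d : ℕ} (μ : Measure (Torus d)) [IsProbabilityMeasure μ]
    (N : ℕ) :
    ∫ p, ‖dirichletKernel d N (p.1 - p.2)‖ ^ 2 ∂μ.prod μ ≤
      ∑ j ∈ Fintype.piFinset fun _ : Fin d => Finset.Ico (0 : ℤ) N,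
        ∑ k ∈ Fintype.piFinset fun _ : Fin d => Finset.Ico (0 : ℤ) N,
          ‖fourierTransform μ (k - j)‖ * ‖fourierTransform μ (j - k)‖ := by
  set S := Fintype.piFinset fun _ : Fin d => Finset.Ico (0 : ℤ) N with hS
  have hexp : ∀ p : Torus d × Torus d, ((‖dirichletKernel d N (p.1 - p.2)‖ ^ 2 : ℝ) : ℂ) =
      ∑ j ∈ S, ∑ k ∈ S,
        UnitAddTorus.mFourier (-(k - j)) p.1 * UnitAddTorus.mFourier (-(j - k)) p.2 := by
    intro p
    have h1 : ∀ j k : Fin d → ℤ, UnitAddTorus.mFourier j (p.1 - p.2) *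
        (starRingEnd ℂ) (UnitAddTorus.mFourier k (p.1 - p.2)) =
        UnitAddTorus.mFourier (-(k - j)) p.1 * UnitAddTorus.mFourier (-(j - k)) p.2 := by
      intro j k
      simp only [UnitAddTorus.mFourier, ContinuousMap.coe_mk, map_prod, ← Finset.prod_mul_distrib]
      refine Finset.prod_congr rfl fun i _ => ?_
      simp only [Pi.sub_apply, Pi.neg_apply]
      rw [← fourier_neg, ← fourier_add, neg_sub, neg_sub, ← sub_eq_add_neg, fourier_apply,
        fourier_apply, fourier_apply, ← Circle.coe_mul, ← AddCircle.toCircle_add]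
      congr 2
      rw [smul_sub, sub_eq_add_neg, ← neg_smul, neg_sub]
    rw [Complex.ofReal_pow, ← Complex.mul_conj', dirichletKernel, map_sum, Finset.sum_mul_sum]
    simp only [h1]
    rfl
  have hcast : ((∫ p, ‖dirichletKernel d N (p.1 - p.2)‖ ^ 2 ∂μ.prod μ : ℝ) : ℂ) =
      ∑ j ∈ S, ∑ k ∈ S, fourierTransform μ (k - j) * fourierTransform μ (j - k) := by
    rw [← integral_complex_ofReal]
    simp only [hexp]
    have hint : ∀ j k : Fin d → ℤ, Integrable (fun p : Torus d × Torus d =>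
        UnitAddTorus.mFourier (-(k - j)) p.1 * UnitAddTorus.mFourier (-(j - k)) p.2)
        (μ.prod μ) := fun j k =>
      (integrable_mFourier μ (-(k - j))).mul_prod (integrable_mFourier μ (-(j - k)))
    rw [integral_finsetSum _ fun j _ => integrable_finsetSum _ fun k _ => hint j k]
    refine Finset.sum_congr rfl fun j _ => ?_
    rw [integral_finsetSum _ fun k _ => hint j k]
    refine Finset.sum_congr rfl fun k _ => ?_
    exact integral_prod_mul (fun x => UnitAddTorus.mFourier (-(k - j)) x)
      (fun y => UnitAddTorus.mFourier (-(j - k)) y)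
  refine (le_abs_self _).trans ?_
  rw [← Real.norm_eq_abs, ← Complex.norm_real, hcast]
  refine (norm_sum_le _ _).trans (Finset.sum_le_sum fun j _ => (norm_sum_le _ _).trans ?_)
  simp only [norm_mul]
  exact le_rfl

/-- Splitting `|ξ| ^ (-s)` into `d` equal factors, each bounded by one coordinate, makes the double
sum over frequencies factor into one-dimensional sums. -/
theorem exists_norm_fourierTransform_mul_le {d : ℕ} (hd : 0 < d) (μ : Measure (Torus d))
    [IsProbabilityMeasure μ] {s : ℝ} (hs : 0 ≤ s) (h : fourierSeminorm s μ < ∞) :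
    ∃ C, 0 ≤ C ∧ ∀ ξ : Fin d → ℤ, ‖fourierTransform μ ξ‖ * ‖fourierTransform μ (-ξ)‖ ≤
      C * ∏ i, max 1 |(ξ i : ℝ)| ^ (-(s / d)) := by
  obtain ⟨C, hC, hμ⟩ := exists_bound_of_weightedSup_lt_top h
  have hd' : (0 : ℝ) < d := by exact_mod_cast hd
  refine ⟨max 1 (C ^ 2), by positivity, fun ξ => ?_⟩
  rcases eq_or_ne ξ 0 with rfl | hξ
  · simp [fourierTransform_zero]
  have h1 := one_le_freqNorm hξ
  have h0 : 0 < freqNorm ξ := by linarith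
  have hneg : freqNorm (-ξ) = freqNorm ξ := by
    have : (WithLp.toLp 2 (fun i => (((-ξ) i : ℤ) : ℝ)) : EuclideanSpace ℝ (Fin d)) =
        -WithLp.toLp 2 (fun i => (ξ i : ℝ)) := by ext i; simp
    rw [freqNorm, this, norm_neg, freqNorm]
  have h2 := hμ ξ
  have h3 := hμ (-ξ)
  rw [hneg] at h3
  have h4 : ‖fourierTransform μ ξ‖ * ‖fourierTransform μ (-ξ)‖ ≤ C ^ 2 * freqNorm ξ ^ (-s) := by
    have h5 : freqNorm ξ ^ (s / 2) * freqNorm ξ ^ (s / 2) * freqNorm ξ ^ (-s) = 1 := by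
      rw [← Real.rpow_add h0, ← Real.rpow_add h0]; simp
    calc _ = (‖fourierTransform μ ξ‖ * freqNorm ξ ^ (s / 2)) *
          (‖fourierTransform μ (-ξ)‖ * freqNorm ξ ^ (s / 2)) * freqNorm ξ ^ (-s) := by
          rw [← mul_one (_ * _), ← h5]; ring
      _ ≤ C * C * freqNorm ξ ^ (-s) := by gcongr
      _ = _ := by ring
  refine h4.trans (mul_le_mul (le_max_right _ _) ?_ (by positivity) (by positivity))
  calc freqNorm ξ ^ (-s) = ∏ _i : Fin d, freqNorm ξ ^ (-(s / d)) := by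
        rw [Finset.prod_const, Finset.card_univ, Fintype.card_fin, ← Real.rpow_natCast,
          ← Real.rpow_mul h0.le]
        congr 1
        field_simp
    _ ≤ _ := Finset.prod_le_prod (fun _ _ => by positivity) fun i _ =>
        Real.rpow_le_rpow_of_nonpos (by positivity) (max_le h1 (abs_le_freqNorm ξ i))
          (by simp only [Left.neg_nonpos_iff]; positivity)

theorem summable_max_one_abs_rpow {b : ℝ} (hb : 1 < b) :
    Summable fun n : ℤ => max 1 |(n : ℝ)| ^ (-b) := by
  refine ((Real.summable_abs_int_rpow hb).add (hasSum_ite_eq (0 : ℤ) (1 : ℝ)).summable).of_nonneg_of_le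
    (fun n => by positivity) fun n => ?_
  rcases eq_or_ne n 0 with rfl | hn
  · have : (0 : ℝ) ^ (-b) = 0 := Real.zero_rpow (by linarith)
    simp [this]
  · have : (1 : ℝ) ≤ |(n : ℝ)| := by exact_mod_cast Int.one_le_abs hn
    rw [max_eq_right this]
    simp [hn]

/-- As `|j - k| ≤ N` and `1 - a + ε ≥ 0`, a factor `N ^ (1 - a + ε)` can be taken out, leaving the
summable exponent `-(1 + ε)`; the loss of `ε` avoids a logarithm at `a = 1`. -/
theorem exists_sum_max_rpow_le {a ε : ℝ} (ha : a ≤ 1) (hε : 0 < ε) :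
    ∃ A, 0 ≤ A ∧ ∀ N : ℕ, 0 < N → ∑ j ∈ Finset.Ico (0 : ℤ) N, ∑ k ∈ Finset.Ico (0 : ℤ) N,
      max 1 |((j - k : ℤ) : ℝ)| ^ (-a) ≤ A * (N : ℝ) ^ (2 - a + ε) := by
  have hsum := summable_max_one_abs_rpow (b := 1 + ε) (by linarith)
  refine ⟨∑' n : ℤ, max 1 |(n : ℝ)| ^ (-(1 + ε)), tsum_nonneg fun _ => by positivity,
    fun N hN => ?_⟩
  have hN' : (0 : ℝ) < N := by exact_mod_cast hN
  have h1 : ∀ j ∈ Finset.Ico (0 : ℤ) N, ∑ k ∈ Finset.Ico (0 : ℤ) N,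
      max 1 |((j - k : ℤ) : ℝ)| ^ (-a) ≤
      (N : ℝ) ^ (1 - a + ε) * ∑' n : ℤ, max 1 |(n : ℝ)| ^ (-(1 + ε)) := by
    intro j hj
    have h2 : ∀ k ∈ Finset.Ico (0 : ℤ) N, max 1 |((j - k : ℤ) : ℝ)| ^ (-a) ≤
        (N : ℝ) ^ (1 - a + ε) * max 1 |((j - k : ℤ) : ℝ)| ^ (-(1 + ε)) := by
      intro k hk
      rw [Finset.mem_Ico] at hj hk
      have hm : max 1 |((j - k : ℤ) : ℝ)| ≤ N := by
        refine max_le (by exact_mod_cast hN) ?_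
        have : |j - k| ≤ (N : ℤ) := by rw [abs_le]; constructor <;> linarith [hj.1, hj.2, hk.1, hk.2]
        exact_mod_cast this
      have hp : 0 < max 1 |((j - k : ℤ) : ℝ)| := by positivity
      have h3 : max 1 |((j - k : ℤ) : ℝ)| ^ (-a) = max 1 |((j - k : ℤ) : ℝ)| ^ (1 - a + ε) *
          max 1 |((j - k : ℤ) : ℝ)| ^ (-(1 + ε)) := by
        rw [← Real.rpow_add hp]; congr 1; ring
      rw [h3]
      exact mul_le_mul_of_nonneg_right (Real.rpow_le_rpow hp.le hm (by linarith)) (by positivity)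
    refine (Finset.sum_le_sum h2).trans ?_
    rw [← Finset.mul_sum]
    gcongr
    have h4 : Summable fun k : ℤ => max 1 |((j - k : ℤ) : ℝ)| ^ (-(1 + ε)) :=
      (Equiv.subLeft j).summable_iff.2 hsum
    refine (h4.sum_le_tsum _ fun _ _ => by positivity).trans (le_of_eq ?_)
    exact (Equiv.subLeft j).tsum_eq fun n : ℤ => max 1 |(n : ℝ)| ^ (-(1 + ε))
  refine (Finset.sum_le_card_nsmul _ _ _ h1).trans (le_of_eq ?_)
  have h5 : (N : ℝ) ^ (2 - a + ε) = N * (N : ℝ) ^ (1 - a + ε) := by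
    rw [show 2 - a + ε = 1 + (1 - a + ε) by ring, Real.rpow_add hN', Real.rpow_one]
  rw [h5, Int.card_Ico, nsmul_eq_mul]
  simp only [sub_zero, Int.toNat_natCast]
  ring

/-- Fourier decay controls the correlation integral `(μ × μ)(|x - y| ≤ r)`. -/
theorem exists_prod_dist_le {d : ℕ} (hd : 0 < d) (μ : Measure (Torus d))
    [IsProbabilityMeasure μ] {s t : ℝ} (hs : 0 ≤ s) (hsd : s ≤ d) (hts : t < s)
    (h : fourierSeminorm s μ < ∞) :
    ∃ C, 0 ≤ C ∧ ∀ N : ℕ, 0 < N → (μ.prod μ) {p | dist p.1 p.2 ≤ 1 / (6 * N)} ≤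
      ENNReal.ofReal (C * (N : ℝ) ^ (-t)) := by
  have hd' : (0 : ℝ) < d := by exact_mod_cast hd
  obtain ⟨C, hC, hμ⟩ := exists_norm_fourierTransform_mul_le hd μ hs h
  -- With this `ε`, the `d`-th power of the one-dimensional bound is of order `N ^ (2 d - t)`;
  -- Markov's inequality divides it by `(N / 2) ^ (2 d)`, leaving `4 ^ d * N ^ (-t)`.
  obtain ⟨A, hA, hsum⟩ := exists_sum_max_rpow_le (a := s / d) (ε := (s - t) / d)
    ((div_le_one hd').2 hsd) (by have : 0 < s - t := by linarith
                                 positivity)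
  refine ⟨C * A ^ d * 4 ^ d, by positivity, fun N hN => ?_⟩
  have hN' : (0 : ℝ) < N := by exact_mod_cast hN
  have hcont : Continuous fun p : Torus d × Torus d => ‖dirichletKernel d N (p.1 - p.2)‖ ^ 2 :=
    (((continuous_dirichletKernel d N).comp (continuous_fst.sub continuous_snd)).norm).pow 2
  have hint : Integrable (fun p : Torus d × Torus d => ‖dirichletKernel d N (p.1 - p.2)‖ ^ 2)
      (μ.prod μ) := hcont.integrable_of_hasCompactSupport (HasCompactSupport.of_compactSpace _)
  have hI : ∫ p, ‖dirichletKernel d N (p.1 - p.2)‖ ^ 2 ∂μ.prod μ ≤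
      C * (A * (N : ℝ) ^ (2 - s / d + (s - t) / d)) ^ d := by
    refine (integral_normSq_dirichletKernel_le μ N).trans ?_
    have h1 : ∀ j k : Fin d → ℤ, ‖fourierTransform μ (k - j)‖ * ‖fourierTransform μ (j - k)‖ ≤
        C * ∏ i, max 1 |((j i - k i : ℤ) : ℝ)| ^ (-(s / d)) := by
      intro j k
      have := hμ (j - k)
      rw [neg_sub, mul_comm] at this
      simpa using this
    refine (Finset.sum_le_sum fun j _ => Finset.sum_le_sum fun k _ => h1 j k).trans ?_
    simp only [← Finset.mul_sum]
    gcongr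
    have h2 : ∀ j : Fin d → ℤ, ∑ k ∈ Fintype.piFinset fun _ : Fin d => Finset.Ico (0 : ℤ) N,
        ∏ i, max 1 |((j i - k i : ℤ) : ℝ)| ^ (-(s / d)) =
        ∏ i, ∑ k ∈ Finset.Ico (0 : ℤ) N, max 1 |((j i - k : ℤ) : ℝ)| ^ (-(s / d)) := fun j =>
      Finset.sum_prod_piFinset (Finset.Ico (0 : ℤ) N)
        fun i k => max 1 |((j i - k : ℤ) : ℝ)| ^ (-(s / d))
    simp only [h2]
    rw [Finset.sum_prod_piFinset (Finset.Ico (0 : ℤ) N) fun (_ : Fin d) j =>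
      ∑ k ∈ Finset.Ico (0 : ℤ) N, max 1 |((j - k : ℤ) : ℝ)| ^ (-(s / d))]
    rw [Finset.prod_const, Finset.card_univ, Fintype.card_fin]
    exact pow_le_pow_left₀ (Finset.sum_nonneg fun _ _ => Finset.sum_nonneg fun _ _ => by positivity)
      (hsum N hN) d
  have hmarkov := mul_meas_ge_le_integral_of_nonneg (ae_of_all _ fun p => by positivity) hint
    (((N / 2 : ℝ) ^ d) ^ 2)
  have hsub : {p : Torus d × Torus d | dist p.1 p.2 ≤ 1 / (6 * N)} ⊆
      {p | ((N / 2 : ℝ) ^ d) ^ 2 ≤ ‖dirichletKernel d N (p.1 - p.2)‖ ^ 2} := by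
    intro p hp
    have hp' : dist p.1 p.2 ≤ 1 / (6 * N) := hp
    rw [dist_eq_norm] at hp'
    exact pow_le_pow_left₀ (by positivity) (le_norm_dirichletKernel hp') 2
  refine (measure_mono hsub).trans ?_
  rw [← ofReal_measureReal]
  refine ENNReal.ofReal_le_ofReal ?_
  have h3 := hmarkov.trans hI
  rw [mul_comm, ← le_div_iff₀ (by positivity)] at h3
  refine h3.trans (le_of_eq ?_)
  have h4 : ((N : ℝ) ^ (2 - s / d + (s - t) / d)) ^ d = (N : ℝ) ^ (-t) * ((N : ℝ) ^ d) ^ 2 := by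
    rw [← Real.rpow_natCast, ← Real.rpow_mul hN'.le, ← Real.rpow_natCast (N : ℝ) d,
      ← Real.rpow_natCast ((N : ℝ) ^ (d : ℝ)) 2, ← Real.rpow_mul hN'.le, ← Real.rpow_add hN']
    congr 1
    field_simp
    push_cast
    ring
  have h5 : (4 : ℝ) ^ d = (2 ^ d) ^ 2 := by rw [← pow_mul, mul_comm, pow_mul]; norm_num
  rw [mul_pow, h4, div_pow, div_pow, h5]
  field_simp

/-! ### Fourier dimension against Hausdorff dimension -/

/-- Fourier decay of a measure bounds the Hausdorff dimension of its carriers from below. -/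
theorem ofReal_le_dimH_of_fourierSeminorm_lt_top {d : ℕ} (μ : Measure (Torus d))
    [IsProbabilityMeasure μ] {s : ℝ} (hsd : s ≤ d) (h : fourierSeminorm s μ < ∞)
    {E : Set (Torus d)} (hE : ∀ᵐ x ∂μ, x ∈ E) : ENNReal.ofReal s ≤ dimH E := by
  refine le_of_forall_lt fun c hc => ?_
  have hct : c ≠ ∞ := hc.ne_top
  have hcs : c.toReal < s := (ENNReal.lt_ofReal_iff_toReal_lt hct).1 hc
  obtain ⟨t, hct', hts⟩ := exists_between hcs
  obtain ⟨t', htt', ht's⟩ := exists_between hts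
  have ht : 0 < t := ENNReal.toReal_nonneg.trans_lt hct'
  have hd : 0 < d := by
    have : (0 : ℝ) < d := (ht.trans hts).trans_le hsd
    exact_mod_cast this
  obtain ⟨C, -, hC⟩ := exists_prod_dist_le hd μ (ht.trans hts).le hsd ht's h
  refine lt_of_lt_of_le ((ENNReal.lt_ofReal_iff_toReal_lt hct).2 hct')
    (le_dimH_of_prod_dist_le μ ht htt' (C := C) (fun k => ?_) hE)
  simpa using hC (2 ^ k) (by positivity)

theorem fourierDim_le_dimH {d : ℕ} (E : Set (Torus d)) : fourierDim E ≤ dimH E := by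
  refine iSup₂_le fun μ hμ => iSup₂_le fun s hs => ?_
  have := hμ.1
  have h1 := ofReal_le_dimH_of_fourierSeminorm_lt_top μ (s := s) (by exact_mod_cast hs.1) hs.2
    (E := E) (by filter_upwards [Measure.support_mem_ae (μ := μ)] with x hx using hμ.2 hx)
  rwa [ENNReal.ofReal_coe_nnreal] at h1

theorem ofReal_le_fourierDim {d : ℕ} {β : ℝ} (hβ : β ≤ d) (p : XSpace d β) :
    ENNReal.ofReal β ≤ fourierDim (p.1.1 : Set (Torus d)) := by
  refine le_of_forall_lt fun c hc => ?_
  have hct : c ≠ ∞ := hc.ne_top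
  obtain ⟨t, hct', htβ⟩ := exists_between ((ENNReal.lt_ofReal_iff_toReal_lt hct).1 hc)
  have ht : 0 ≤ t := ENNReal.toReal_nonneg.trans hct'.le
  refine ((ENNReal.lt_ofReal_iff_toReal_lt hct).2 hct').trans_le ?_
  refine le_trans ?_ (le_iSup₂_of_le p.1.2.1 p.2 le_rfl)
  refine le_iSup₂_of_le (f := fun (s : ℝ≥0) _ => (s : ℝ≥0∞)) t.toNNReal ⟨?_, ?_⟩ le_rfl
  · rw [Real.toNNReal_le_iff_le_coe]
    exact_mod_cast htβ.le.trans hβ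
  · rw [Real.coe_toNNReal _ ht]
    exact p.1.2.2.2 t ht htβ

end SalemGeneric

end

theorem mainTheorem6 (d : ℕ) (β : ℝ) (hβ_pos : 0 < β) (hβ_le : β ≤ d) :
    ∀ᶠ p : SalemGeneric.XSpace d β in residual (SalemGeneric.XSpace d β),
      SalemGeneric.IsSalem (p.1.1 : Set (SalemGeneric.Torus d)) ∧
        dimH (p.1.1 : Set (SalemGeneric.Torus d)) = ENNReal.ofReal β := by
  have hd : 0 < d := by
    have : (0 : ℝ) < d := hβ_pos.trans_le hβ_le
    exact_mod_cast this
  filter_upwards [SalemGeneric.eventually_residual_dimH_le hd hβ_pos] with p hp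
  have h1 := SalemGeneric.ofReal_le_fourierDim hβ_le p
  have h2 := SalemGeneric.fourierDim_le_dimH (p.1.1 : Set (SalemGeneric.Torus d))
  exact ⟨le_antisymm h2 (hp.trans h1), le_antisymm hp (h1.trans h2)⟩
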